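/- Let $\mathbb L$ be the square, triangular or hexagonal lattice, embedded in $\mathbb R^2$ as a regular tessellation with edges of length $1$ and with a site at the origin $o$. A configuration is identified with its set $\omega\subset V(\mathbb L)$ of open sites. An *enhancement* of range $R_0<\infty$ is a family of maps $\phi_x$, $x\in V(\mathbb L)$, on configurations such that $\phi_x(\omega)$ depends only on $\omega\cap B_x(R_0)$, $\phi_x(\omega)\subset V(\mathbb L)\cap B_x(R_0)$, where $B_x(R_0)$ is the closed Euclidean disc centred at $x$, and $\phi_{x+t}(\omega)=t+\phi_x(\omega-t)$ for every translation $t$ preserving $\mathbb L$. (For the square and triangular lattices it is determined by $\phi_o$; for the hexagonal lattice, by one function for each of the two translation classes of sites.) It is *monotonic* if $\omega\subset\omega'$ implies $\phi_x(\omega)\subset\phi_x(\omega')$ for all $x$. It is *essential* if for some site $x$ (for the square and triangular lattices, equivalently for $x=o$) there is a configuration $\omega$ containing no doubly-infinite self-repelling path such that $\omega\cup\phi_x(\omega)$ contains one; a path is self-repelling if none of its sites is adjacent to any other site of the path except its neighbours along the path. Given $p,s\in[0,1]$, let each site be open with probability $p$ and activated with probability $s$, all independently. If $\omega$ is the set of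 open sites and $A$ the set of activated sites, the enhanced configuration is $\hat\omega=\omega\cup\bigcup_{x\in A}\phi_x(\omega)$. For a family of laws $(P_p)_{p\in[0,1]}$ of random configurations, let $C$ be the open cluster of the origin and put $\theta(p)=P_p(|C|=\infty)$, $\tau_p(x)=P_p(x\in C)$, $\chi(p)=E_p|C|$, $p_c=\sup\{p:\theta(p)=0\}$. For an infinite set $S$ of sites let $\xi_S(p)\in(0,\infty)$ be defined by $$\xi_S(p)^{-1}=\lim_{|x|\to\infty,\ x\in S}\Big\{-\frac1{|x|}\log\tau_p(x)\Big\}$$ when this limit exists in $(0,\infty)$. The critical exponents are the real numbers defined as follows, whenever the limits exist: $$\beta=\lim_{p\downarrow p_c}\frac{\log\theta(p)}{\log(p-p_c)},\quad -\eta=\lim_{|x|\to\infty}\frac{\log\tau_{p_c}(x)}{\log|x|},\quad -\nu_S=\lim_{p\uparrow p_c}\frac{\log\xi_S(p)}{\log(p_c-p)},$$ $$-\gamma=\lim_{p\uparrow p_c}\frac{\log\chi(p)}{\log(p_c-p)},\quad -\frac1\delta=\lim_{n\to\infty}\frac{\log P_{p_c}(|C|\ge n)}{\log n}\quad(\delta>0),$$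 where the existence of $\nu_S$ (resp. $\gamma$) includes that $\xi_S(p)$ is defined (resp. $\chi(p)<\infty$) for all $p<p_c$ close enough to $p_c$. **Theorem.** Let $\phi$ be a monotonic enhancement on $\mathbb L$ that is not essential, and let $s\in[0,1]$. If one of the exponents $\beta$, $\eta$, $\nu_S$ (with $S$ any infinite set of sites), $\gamma$, $\delta$ exists for independent site percolation on $\mathbb L$, then it exists also for the enhanced percolation process with density of enhancement $s$ (the family of laws of $\hat\omega$, indexed by $p$), and has the same value. In particular, if all of them exist for independent site percolation, then all of them exist, with the same values, for the enhanced process. -/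

import Mathlib

open Filter Topology MeasureTheory ProbabilityTheory unitInterval

/-- The three regular tessellations of the plane, viewed as infinite graphs. -/
inductive PlanarLattice where
  | square
  | triangular
  | hexagonal

namespace PlanarLattice

/-- Number of orbits of sites under the translations of the lattice. -/
def numTypes : PlanarLattice → ℕ
  | square => 1
  | triangular => 1
  | hexagonal => 2

/-- A site is given by the fundamental cell containing it and by its type within the cell. -/
abbrev Site (L : PlanarLattice) : Type := (ℤ × ℤ) × Fin L.numTypes

/-- First generator of the group of translations. -/
noncomputable def e₁ : PlanarLattice → ℂ
  | square => 1
  | triangular => 1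
  | hexagonal => ⟨3 / 2, √3 / 2⟩

/-- Second generator of the group of translations. -/
noncomputable def e₂ : PlanarLattice → ℂ
  | square => ⟨0, 1⟩
  | triangular => ⟨1 / 2, √3 / 2⟩
  | hexagonal => ⟨3 / 2, -(√3 / 2)⟩

variable {L : PlanarLattice}

/-- The position of a site in the plane `ℝ² = ℂ`. The sites of the square lattice are the Gaussian
integers, those of the triangular lattice are the Eisenstein integers; in the hexagonal lattice
the two sites of a cell differ by the vector `1`. -/
noncomputable def pos (x : L.Site) : ℂ :=
  (x.1.1 : ℂ) * L.e₁ + (x.1.2 : ℂ) * L.e₂ + ((x.2 : ℕ) : ℂ)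

/-- The origin. -/
def origin (L : PlanarLattice) : L.Site := ((0, 0), ⟨0, by cases L <;> decide⟩)

/-- The lattice as a graph: all edges have length `1`, and two sites are adjacent exactly when
their Euclidean distance is `1`. -/
def graph (L : PlanarLattice) : SimpleGraph L.Site where
  Adj x y := ‖pos x - pos y‖ = 1
  symm := ⟨fun x y h => by rw [norm_sub_rev]; exact h⟩
  loopless := ⟨fun x h => by simp at h⟩

/-- The sites in the closed Euclidean disc of radius `r` centred at the site `x`. -/
def ball (x : L.Site) (r : ℝ) : Set L.Site := {y | ‖pos y - pos x‖ ≤ r}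

/-- Translation by the lattice vector `u.1 • e₁ + u.2 • e₂`. -/
def shift (u : ℤ × ℤ) (x : L.Site) : L.Site := (u + x.1, x.2)

/-! ### Clusters -/

/-- The open cluster of `x` in the configuration `ω` (the set of open sites): all sites joined to
`x` by a path of open sites. It is empty if `x` is closed. -/
def cluster (ω : Set L.Site) (x : L.Site) : Set L.Site :=
  {y | ∃ w : L.graph.Walk x y, ∀ z ∈ w.support, z ∈ ω}

/-- `ω` contains a doubly-infinite self-repelling path: sites `γ n`, `n ∈ ℤ`, in which each site is
adjacent to its predecessor and its successor and to no other site of the path. -/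
def HasDoublyInfinitePath (ω : Set L.Site) : Prop :=
  ∃ γ : ℤ → L.Site, Function.Injective γ ∧ (∀ n, γ n ∈ ω) ∧
    ∀ m n, L.graph.Adj (γ m) (γ n) ↔ |m - n| = 1

end PlanarLattice

open PlanarLattice

/-- An enhancement of finite range: local functions `φ x`, one for each site, which commute with
the translations of the lattice. For the square and the triangular lattice, on which the
translations act transitively on the sites, `φ` is determined by the enhancement function
`φ L.origin` through `φ_x(ω) = x + φ_o(τ_x ω)`. For the hexagonal lattice there are two orbits of
sites, and `φ` is determined by one enhancement function for each of the two. -/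
structure Enhancement (L : PlanarLattice) where
  /-- The set of sites opened by the enhancement at `x`, when activated. -/
  φ : L.Site → Set L.Site → Set L.Site
  /-- The enhancement range. -/
  range : ℝ
  local_dep : ∀ x ω ω', ω ∩ ball x range = ω' ∩ ball x range → φ x ω = φ x ω'
  local_effect : ∀ x ω, φ x ω ⊆ ball x range
  equivariant : ∀ (u : ℤ × ℤ) x ω, φ (shift u x) ω = shift u '' φ x (shift u ⁻¹' ω)

namespace Enhancement

variable {L : PlanarLattice} (E : Enhancement L)

/-- Monotonic enhancements. -/
def IsMonotonic : Prop := ∀ x ω ω', ω ⊆ ω' → E.φ x ω ⊆ E.φ x ω'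

/-- Essential enhancements: in some configuration without a doubly-infinite self-repelling path,
the activation of the enhancement at a single site creates such a path. By equivariance, that site
may be taken to be the origin for the square and the triangular lattice. -/
def IsEssential : Prop :=
  ∃ x ω, ¬ HasDoublyInfinitePath ω ∧ HasDoublyInfinitePath (ω ∪ E.φ x ω)

/-- The enhanced configuration; `A` is the set of sites at which the enhancement is activated. -/
def enhanced (ω A : Set L.Site) : Set L.Site := ω ∪ ⋃ x ∈ A, E.φ x ω

end Enhancement

/-! ### The two families of percolation processes, indexed by the density of open sites -/

/-- Independent site percolation: every site is open with probability `p`, independently. -/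
noncomputable def indepPerc (L : PlanarLattice) (p : I) : Measure (Set L.Site) :=
  setBernoulli Set.univ p

/-- Enhanced percolation: the law of the enhanced configuration, when the initial configuration has
density `p` and the enhancement is activated with density `s`, independently. -/
noncomputable def enhancedPerc {L : PlanarLattice} (E : Enhancement L) (s p : I) :
    Measure (Set L.Site) :=
  ((setBernoulli Set.univ p).prod (setBernoulli Set.univ s)).map
    fun c : Set L.Site × Set L.Site => E.enhanced c.1 c.2

/-! ### Critical exponents of a percolation process with law `μ p` at density `p` -/

namespace Percolation

variable {L : PlanarLattice} (μ : I → Measure (Set L.Site))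

/-- Percolation probability. -/
noncomputable def theta (p : I) : ℝ := (μ p).real {ω | (cluster ω L.origin).Infinite}

/-- Connectivity function. -/
noncomputable def tau (p : I) (x : L.Site) : ℝ := (μ p).real {ω | x ∈ cluster ω L.origin}

/-- Mean cluster size. -/
noncomputable def chi (p : I) : ENNReal := ∫⁻ ω, ((cluster ω L.origin).encard : ENNReal) ∂(μ p)

/-- The critical point of the process. -/
noncomputable def criticalPoint : I := sSup {p | theta μ p = 0}

/-- `log θ(p) / log (p - p_c) → β` as `p ↓ p_c`. -/
def HasBeta (β : ℝ) : Prop :=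
  Tendsto (fun p : I => Real.log (theta μ p) / Real.log (p - criticalPoint μ))
    (𝓝[>] (criticalPoint μ)) (𝓝 β)

/-- `log τ_{p_c}(x) / log |x| → -η` as `|x| → ∞`. -/
def HasEta (η : ℝ) : Prop :=
  Tendsto (fun x : L.Site => Real.log (tau μ (criticalPoint μ) x) / Real.log ‖pos x‖)
    cofinite (𝓝 (-η))

/-- `ξ` is the correlation length at density `p` along the set of sites `S`:
`ξ⁻¹` is the limit of `-(1 / |x|) log τ_p(x)` as `|x| → ∞` with `x ∈ S`. -/
def HasCorrelationLength (S : Set L.Site) (p : I) (ξ : ℝ) : Prop :=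
  0 < ξ ∧ Tendsto (fun x : L.Site => -(1 / ‖pos x‖) * Real.log (tau μ p x))
    (cofinite ⊓ 𝓟 S) (𝓝 ξ⁻¹)

/-- The correlation length along `S` exists below and near `p_c`, and
`log ξ(p) / log (p_c - p) → -ν` as `p ↑ p_c`. -/
def HasNu (S : Set L.Site) (ν : ℝ) : Prop :=
  ∃ ξ : I → ℝ, (∀ᶠ p in 𝓝[<] (criticalPoint μ), HasCorrelationLength μ S p (ξ p)) ∧
    Tendsto (fun p : I => Real.log (ξ p) / Real.log (criticalPoint μ - p))
      (𝓝[<] (criticalPoint μ)) (𝓝 (-ν))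

/-- The mean cluster size is finite below and near `p_c`, and
`log χ(p) / log (p_c - p) → -γ` as `p ↑ p_c`. -/
def HasGamma (γ : ℝ) : Prop :=
  (∀ᶠ p in 𝓝[<] (criticalPoint μ), chi μ p ≠ ⊤) ∧
    Tendsto (fun p : I => Real.log (chi μ p).toReal / Real.log (criticalPoint μ - p))
      (𝓝[<] (criticalPoint μ)) (𝓝 (-γ))

/-- `log P_{p_c}(|C| ≥ n) / log n → -1/δ` as `n → ∞`, where `C` is the cluster of the origin. -/
def HasDelta (δ : ℝ) : Prop :=
  0 < δ ∧ Tendsto (fun n : ℕ =>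
      Real.log ((μ (criticalPoint μ)).real {ω | (n : ℕ∞) ≤ (cluster ω L.origin).encard}) /
        Real.log n) atTop (𝓝 (-(1 / δ)))

end Percolation

/-!
The enhanced configuration contains the initial one, so its clusters can only be larger. The point
is that they are not much larger: for some `R`, if `y` and `z` are connected in the enhanced
configuration and are further than `R` apart, then some site within `R` of `y` is connected to
some site within `R` of `z` in the initial configuration
(`Enhancement.exists_mem_cluster_of_mem_cluster_enhanced`).

This is deduced from the case of a single activation, at `x` say
(`Enhancement.mem_cluster_of_mem_cluster_union`): it creates no connection between sites outside a
box `D` around `x`. Suppose that it does. Then two boundary sites `b`, `b'` of `D`, open and not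
connected before the activation, become connected inside `D` (`exists_boundary_pair`). Replace the
configuration outside the interior of `D` by two rays which start at `b` and `b'` and do not touch
each other (`exists_escape`, proved separately for the hexagonal lattice). The new configuration has no doubly-infinite self-repelling path, since such a path
would have to use both rays and to connect `b` and `b'` (`not_hasDoublyInfinitePath_of_escape`).
After the activation, the two rays and a shortest connection of `b` and `b'` inside `D` form such
a path (`hasDoublyInfinitePath_of_escape`). As the action at `x` depends only on the interior of
`D`, the enhancement is essential, a contradiction.

For the general case, open all sites in large boxes around `y` and `z`, which is harmless by
monotonicity, and apply the finitely many activations that matter one after the other. Those close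
to `y` or `z` add nothing, since they see an open box, and the others create no connection between
`y` and `z`.

Opening the sites of a given finite set costs only a constant factor in probability
(`pow_mul_setBernoulli_union_le`). Hence the percolation probability, the connectivity function,
the mean cluster size and the tail of the cluster size of the two processes agree up to constant
factors, for the tail also in its argument, uniformly for `p` bounded away from `0`
(`exists_comparison`). As the critical point is positive (`criticalPoint_pos`), it is the same for
the two processes, and so are the critical exponents.
-/

namespace PlanarLattice

/-! ### Coordinates on the three lattices -/

/-- The sites whose cell differs from the cell of `x` by at most `n` in each coordinate. -/
def box {L : PlanarLattice} (x : L.Site) (n : ℕ) : Set L.Site :=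
  {y | x.1.1 - n ≤ y.1.1 ∧ y.1.1 ≤ x.1.1 + n ∧ x.1.2 - n ≤ y.1.2 ∧ y.1.2 ≤ x.1.2 + n}

lemma norm_eq_one_iff_of_normSq_eq {z : ℂ} {q : ℤ} (h : Complex.normSq z = q) :
    ‖z‖ = 1 ↔ q = 1 := by
  rw [Complex.normSq_eq_norm_sq] at h
  constructor
  · intro hz
    rw [hz] at h
    exact_mod_cast (by simpa using h.symm : (q : ℝ) = 1)
  · rintro rfl
    have : ‖z‖ ^ 2 = 1 := by simpa using h
    nlinarith [norm_nonneg z]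

lemma type_square (x : square.Site) : (x.2 : ℕ) = 0 := by
  have h : (x.2 : ℕ) < 1 := x.2.2
  omega

lemma type_triangular (x : triangular.Site) : (x.2 : ℕ) = 0 := by
  have h : (x.2 : ℕ) < 1 := x.2.2
  omega

lemma type_hexagonal (x : hexagonal.Site) : (x.2 : ℕ) < 2 := x.2.2

lemma normSq_square (x y : square.Site) : Complex.normSq (pos x - pos y) =
    (((x.1.1 - y.1.1) ^ 2 + (x.1.2 - y.1.2) ^ 2 : ℤ) : ℝ) := by
  simp [pos, e₁, e₂, Complex.normSq_apply, type_square]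
  ring

lemma normSq_triangular (x y : triangular.Site) : Complex.normSq (pos x - pos y) =
    (((x.1.1 - y.1.1) ^ 2 + (x.1.1 - y.1.1) * (x.1.2 - y.1.2) + (x.1.2 - y.1.2) ^ 2 : ℤ) : ℝ) := by
  have h3 : √3 * √3 = (3 : ℝ) := Real.mul_self_sqrt (by norm_num)
  simp [pos, e₁, e₂, Complex.normSq_apply, type_triangular]
  linear_combination ((x.1.2 : ℝ) - y.1.2) ^ 2 / 4 * h3

lemma normSq_hexagonal (x y : hexagonal.Site) : Complex.normSq (pos x - pos y) =
    ((3 * (x.1.1 - y.1.1) ^ 2 + 3 * (x.1.1 - y.1.1) * (x.1.2 - y.1.2) + 3 * (x.1.2 - y.1.2) ^ 2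
      + 3 * ((x.1.1 - y.1.1) + (x.1.2 - y.1.2)) * ((x.2 : ℕ) - (y.2 : ℕ))
      + ((x.2 : ℕ) - (y.2 : ℕ)) ^ 2 : ℤ) : ℝ) := by
  have h3 : √3 * √3 = (3 : ℝ) := Real.mul_self_sqrt (by norm_num)
  simp [pos, e₁, e₂, Complex.normSq_apply]
  linear_combination (((x.1.1 : ℝ) - y.1.1) - (x.1.2 - y.1.2)) ^ 2 / 4 * h3

lemma adj_square_iff (x y : square.Site) : square.graph.Adj x y ↔
    (x.1.2 = y.1.2 ∧ (x.1.1 = y.1.1 + 1 ∨ y.1.1 = x.1.1 + 1)) ∨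
    (x.1.1 = y.1.1 ∧ (x.1.2 = y.1.2 + 1 ∨ y.1.2 = x.1.2 + 1)) := by
  change ‖pos x - pos y‖ = 1 ↔ _
  rw [norm_eq_one_iff_of_normSq_eq (normSq_square x y)]
  obtain ⟨a, ha⟩ : ∃ a, a = x.1.1 - y.1.1 := ⟨_, rfl⟩
  obtain ⟨b, hb⟩ : ∃ b, b = x.1.2 - y.1.2 := ⟨_, rfl⟩
  rw [← ha, ← hb]
  constructor
  · intro h
    have h1 : -1 ≤ a := by nlinarith
    have h2 : a ≤ 1 := by nlinarith
    have h3 : -1 ≤ b := by nlinarith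
    have h4 : b ≤ 1 := by nlinarith
    interval_cases a <;> interval_cases b <;> simp at h <;> omega
  · intro h
    have : (b = 0 ∧ (a = 1 ∨ a = -1)) ∨ (a = 0 ∧ (b = 1 ∨ b = -1)) := by omega
    rcases this with ⟨rfl, rfl | rfl⟩ | ⟨rfl, rfl | rfl⟩ <;> norm_num

lemma adj_triangular_iff (x y : triangular.Site) : triangular.graph.Adj x y ↔
    (x.1.2 = y.1.2 ∧ (x.1.1 = y.1.1 + 1 ∨ y.1.1 = x.1.1 + 1)) ∨
    (x.1.1 = y.1.1 ∧ (x.1.2 = y.1.2 + 1 ∨ y.1.2 = x.1.2 + 1)) ∨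
    (x.1.1 = y.1.1 + 1 ∧ y.1.2 = x.1.2 + 1) ∨ (y.1.1 = x.1.1 + 1 ∧ x.1.2 = y.1.2 + 1) := by
  change ‖pos x - pos y‖ = 1 ↔ _
  rw [norm_eq_one_iff_of_normSq_eq (normSq_triangular x y)]
  obtain ⟨a, ha⟩ : ∃ a, a = x.1.1 - y.1.1 := ⟨_, rfl⟩
  obtain ⟨b, hb⟩ : ∃ b, b = x.1.2 - y.1.2 := ⟨_, rfl⟩
  rw [← ha, ← hb]
  constructor
  · intro h
    have h1 : -1 ≤ a := by nlinarith [sq_nonneg (a + 2 * b)]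
    have h2 : a ≤ 1 := by nlinarith [sq_nonneg (a + 2 * b)]
    have h3 : -1 ≤ b := by nlinarith [sq_nonneg (b + 2 * a)]
    have h4 : b ≤ 1 := by nlinarith [sq_nonneg (b + 2 * a)]
    interval_cases a <;> interval_cases b <;> simp at h <;> omega
  · intro h
    have : (b = 0 ∧ (a = 1 ∨ a = -1)) ∨ (a = 0 ∧ (b = 1 ∨ b = -1)) ∨ (a = 1 ∧ b = -1) ∨
        (a = -1 ∧ b = 1) := by omega
    rcases this with ⟨rfl, rfl | rfl⟩ | ⟨rfl, rfl | rfl⟩ | ⟨rfl, rfl⟩ | ⟨rfl, rfl⟩ <;> norm_num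

lemma adj_hexagonal_iff (x y : hexagonal.Site) : hexagonal.graph.Adj x y ↔
    ((x.2 : ℕ) = 1 ∧ (y.2 : ℕ) = 0 ∧ ((y.1.1 = x.1.1 ∧ y.1.2 = x.1.2) ∨
      (y.1.1 = x.1.1 + 1 ∧ y.1.2 = x.1.2) ∨ (y.1.1 = x.1.1 ∧ y.1.2 = x.1.2 + 1))) ∨
    ((y.2 : ℕ) = 1 ∧ (x.2 : ℕ) = 0 ∧ ((y.1.1 = x.1.1 ∧ y.1.2 = x.1.2) ∨
      (x.1.1 = y.1.1 + 1 ∧ y.1.2 = x.1.2) ∨ (y.1.1 = x.1.1 ∧ x.1.2 = y.1.2 + 1))) := by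
  change ‖pos x - pos y‖ = 1 ↔ _
  rw [norm_eq_one_iff_of_normSq_eq (normSq_hexagonal x y)]
  obtain ⟨a, ha⟩ : ∃ a, a = x.1.1 - y.1.1 := ⟨_, rfl⟩
  obtain ⟨b, hb⟩ : ∃ b, b = x.1.2 - y.1.2 := ⟨_, rfl⟩
  have hx := type_hexagonal x
  have hy := type_hexagonal y
  generalize hs : (x.2 : ℕ) = s at *
  generalize ht : (y.2 : ℕ) = t at *
  rw [← ha, ← hb]
  constructor
  · intro h
    have h1 : -1 ≤ a := by
      interval_cases s <;> interval_cases t <;> norm_num at h <;>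
        nlinarith [sq_nonneg (a + 2 * b + 1), sq_nonneg (a + 2 * b - 1), sq_nonneg (a + 2 * b)]
    have h2 : a ≤ 1 := by
      interval_cases s <;> interval_cases t <;> norm_num at h <;>
        nlinarith [sq_nonneg (a + 2 * b + 1), sq_nonneg (a + 2 * b - 1), sq_nonneg (a + 2 * b)]
    have h3 : -1 ≤ b := by
      interval_cases s <;> interval_cases t <;> norm_num at h <;>
        nlinarith [sq_nonneg (b + 2 * a + 1), sq_nonneg (b + 2 * a - 1), sq_nonneg (b + 2 * a)]
    have h4 : b ≤ 1 := by
      interval_cases s <;> interval_cases t <;> norm_num at h <;>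
        nlinarith [sq_nonneg (b + 2 * a + 1), sq_nonneg (b + 2 * a - 1), sq_nonneg (b + 2 * a)]
    interval_cases s <;> interval_cases t <;> interval_cases a <;> interval_cases b <;>
      norm_num at h <;> omega
  · intro h
    rcases h with ⟨rfl, rfl, h⟩ | ⟨rfl, rfl, h⟩
    · have : (a = 0 ∧ b = 0) ∨ (a = -1 ∧ b = 0) ∨ (a = 0 ∧ b = -1) := by omega
      rcases this with ⟨rfl, rfl⟩ | ⟨rfl, rfl⟩ | ⟨rfl, rfl⟩ <;> norm_num
    · have : (a = 0 ∧ b = 0) ∨ (a = 1 ∧ b = 0) ∨ (a = 0 ∧ b = 1) := by omega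
      rcases this with ⟨rfl, rfl⟩ | ⟨rfl, rfl⟩ | ⟨rfl, rfl⟩ <;> norm_num

lemma site_ext {L : PlanarLattice} {x y : L.Site} (h1 : x.1.1 = y.1.1) (h2 : x.1.2 = y.1.2)
    (h3 : (x.2 : ℕ) = y.2) : x = y :=
  Prod.ext (Prod.ext h1 h2) (Fin.ext h3)

variable {L : PlanarLattice}

lemma mem_box_one_of_adj {x y : L.Site} (h : L.graph.Adj x y) : y ∈ box x 1 := by
  simp only [box, Set.mem_ofPred_eq]
  cases L
  · rw [adj_square_iff] at h; push_cast; omega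
  · rw [adj_triangular_iff] at h; push_cast; omega
  · rw [adj_hexagonal_iff] at h; push_cast; omega

lemma self_mem_box (x : L.Site) (n : ℕ) : x ∈ box x n := by
  simp only [box, Set.mem_ofPred_eq]; omega

lemma mem_box_comm {x y : L.Site} {n : ℕ} : y ∈ box x n ↔ x ∈ box y n := by
  simp only [box, Set.mem_ofPred_eq]; omega

lemma mem_box_trans {x y z : L.Site} {m n : ℕ} (hy : y ∈ box x m) (hz : z ∈ box y n) :
    z ∈ box x (m + n) := by
  simp only [box, Set.mem_ofPred_eq] at *; push_cast; omega

lemma box_mono (x : L.Site) {m n : ℕ} (h : m ≤ n) : box x m ⊆ box x n := by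
  intro y hy
  simp only [box, Set.mem_ofPred_eq] at *; omega

/-- The finite set of integer offsets and types that parametrizes every box of radius `n`. -/
noncomputable def boxCode (L : PlanarLattice) (n : ℕ) : Finset ((ℤ × ℤ) × Fin L.numTypes) :=
  (Finset.Icc (-n : ℤ) n ×ˢ Finset.Icc (-n : ℤ) n) ×ˢ Finset.univ

lemma box_eq_image (x : L.Site) (n : ℕ) :
    box x n = (fun c : (ℤ × ℤ) × Fin L.numTypes => ((x.1 + c.1, c.2) : L.Site)) '' boxCode L n := by
  ext y
  simp only [box, boxCode, Set.mem_ofPred_eq, Set.mem_image, Finset.mem_coe, Finset.mem_product,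
    Finset.mem_Icc, Finset.mem_univ, and_true]
  constructor
  · intro h
    refine ⟨((y.1.1 - x.1.1, y.1.2 - x.1.2), y.2), by simp only; omega, ?_⟩
    apply site_ext <;> simp
  · rintro ⟨c, hc, rfl⟩
    simp only [Prod.fst_add, Prod.snd_add]
    omega

lemma box_finite (x : L.Site) (n : ℕ) : (box x n).Finite := by
  rw [box_eq_image]
  exact (boxCode L n).finite_toSet.image _

lemma box_encard_le (x : L.Site) (n : ℕ) : (box x n).encard ≤ (boxCode L n).card := by
  rw [box_eq_image]
  exact (Set.encard_image_le _ _).trans (by simp)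

lemma ball_subset_box (x : L.Site) (r : ℝ) {m : ℕ} (hm : 2 * r + 2 ≤ m) :
    ball x r ⊆ box x m := by
  intro y hy
  have hy' : ‖pos y - pos x‖ ≤ r := hy
  have hr : 0 ≤ r := (norm_nonneg _).trans hy'
  have hsq : Complex.normSq (pos y - pos x) ≤ r ^ 2 := by
    rw [Complex.normSq_eq_norm_sq]; gcongr
  have key : ∀ a : ℤ, (a : ℝ) ^ 2 ≤ (2 * r + 2) ^ 2 → -(m : ℤ) ≤ a ∧ a ≤ m := by
    intro a ha
    have := abs_le_of_sq_le_sq' ha (by linarith)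
    constructor
    · have : (-(m : ℤ) : ℝ) ≤ a := by push_cast; linarith
      exact_mod_cast this
    · have : (a : ℝ) ≤ (m : ℤ) := by push_cast; linarith
      exact_mod_cast this
  suffices h : ((y.1.1 - x.1.1 : ℤ) : ℝ) ^ 2 ≤ (2 * r + 2) ^ 2 ∧
      ((y.1.2 - x.1.2 : ℤ) : ℝ) ^ 2 ≤ (2 * r + 2) ^ 2 by
    have h1 := key _ h.1
    have h2 := key _ h.2
    simp only [box, Set.mem_ofPred_eq]; omega
  cases L
  · rw [normSq_square] at hsq
    generalize y.1.1 - x.1.1 = a at *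
    generalize y.1.2 - x.1.2 = b at *
    push_cast at hsq
    constructor <;> nlinarith [sq_nonneg (a : ℝ), sq_nonneg (b : ℝ)]
  · rw [normSq_triangular] at hsq
    generalize y.1.1 - x.1.1 = a at *
    generalize y.1.2 - x.1.2 = b at *
    push_cast at hsq
    constructor <;> nlinarith [sq_nonneg ((a : ℝ) + 2 * b), sq_nonneg (2 * (a : ℝ) + b)]
  · rw [normSq_hexagonal] at hsq
    have hs := type_hexagonal x
    have ht := type_hexagonal y
    generalize y.1.1 - x.1.1 = a at *
    generalize y.1.2 - x.1.2 = b at *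
    generalize (x.2 : ℕ) = s at *
    generalize (y.2 : ℕ) = t at *
    push_cast at hsq
    have hst : ((t : ℝ) - s) ^ 2 ≤ 1 := by
      interval_cases s <;> interval_cases t <;> norm_num
    generalize (t : ℝ) - s = u at *
    have h1 : (3 * ((a : ℝ) + b) / 2 + u) ^ 2 + 3 / 4 * ((a : ℝ) - b) ^ 2 ≤ r ^ 2 := by
      nlinarith
    have h2 := abs_le_of_sq_le_sq' (show (3 * ((a : ℝ) + b) / 2 + u) ^ 2 ≤ r ^ 2 by
      nlinarith [sq_nonneg ((a : ℝ) - b)]) hr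
    have h3 := abs_le_of_sq_le_sq' (show ((a : ℝ) - b) ^ 2 ≤ (2 * r) ^ 2 by
      nlinarith [sq_nonneg (3 * ((a : ℝ) + b) / 2 + u)]) (by linarith)
    have h4 := abs_le_of_sq_le_sq' (show u ^ 2 ≤ 1 ^ 2 by simpa using hst) zero_le_one
    constructor <;> apply sq_le_sq' <;> linarith [h2.1, h2.2, h3.1, h3.2, h4.1, h4.2]

/-! ### Escaping from a box along two rays -/

/-- A sequence of sites without repetitions, in which exactly the consecutive ones are adjacent. -/
structure IsRay {L : PlanarLattice} (r : ℕ → L.Site) : Prop where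
  injective : Function.Injective r
  adj_iff : ∀ k l, L.graph.Adj (r k) (r l) ↔ k = l + 1 ∨ l = k + 1

/-- Two rays which neither meet nor touch, starting at `b` and `b'` and avoiding `D` otherwise. -/
structure IsEscape {L : PlanarLattice} (D : Set L.Site) (b b' : L.Site) (r r' : ℕ → L.Site) :
    Prop where
  isRay : IsRay r
  isRay' : IsRay r'
  zero : r 0 = b
  zero' : r' 0 = b'
  notMem : ∀ k, r (k + 1) ∉ D
  notMem' : ∀ k, r' (k + 1) ∉ D
  ne : ∀ k l, r k ≠ r' l
  not_adj : ∀ k l, ¬ L.graph.Adj (r k) (r' l)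

/-- On the square and the triangular lattice, the two rays are straight half-lines, each of them
perpendicular (in cell coordinates) to the side of the box from which it starts. -/
lemma exists_escape_of_ne_hexagonal {L : PlanarLattice} (hL : L ≠ hexagonal) (x : L.Site) (n : ℕ)
    {b b' c c' : L.Site} (hb : b ∈ box x n) (hb' : b' ∈ box x n) (hc : c ∉ box x n)
    (hc' : c' ∉ box x n) (hbc : L.graph.Adj b c) (hbc' : L.graph.Adj b' c') (hne : b ≠ b')
    (hadj : ¬ L.graph.Adj b b') : ∃ r r', IsEscape (box x n) b b' r r' := by
  have hne' : ¬ (b.1.1 = b'.1.1 ∧ b.1.2 = b'.1.2) := by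
    refine fun h => hne (site_ext h.1 h.2 ?_)
    cases L
    · rw [type_square, type_square]
    · rw [type_triangular, type_triangular]
    · exact absurd rfl hL
  have side : ∀ {b c : L.Site}, b ∈ box x n → c ∉ box x n → L.graph.Adj b c →
      ∃ d e : ℤ, (d = 1 ∧ e = 0 ∧ b.1.1 = x.1.1 + n) ∨ (d = -1 ∧ e = 0 ∧ b.1.1 = x.1.1 - n) ∨
        (d = 0 ∧ e = 1 ∧ b.1.2 = x.1.2 + n) ∨ (d = 0 ∧ e = -1 ∧ b.1.2 = x.1.2 - n) := by
    intro b c hb hc h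
    have h := mem_box_one_of_adj h
    simp only [box, Set.mem_ofPred_eq] at h hb hc
    have : b.1.1 = x.1.1 + n ∨ b.1.1 = x.1.1 - n ∨ b.1.2 = x.1.2 + n ∨ b.1.2 = x.1.2 - n := by
      omega
    rcases this with h | h | h | h
    exacts [⟨_, _, .inl ⟨rfl, rfl, h⟩⟩, ⟨_, _, .inr (.inl ⟨rfl, rfl, h⟩)⟩,
      ⟨_, _, .inr (.inr (.inl ⟨rfl, rfl, h⟩))⟩, ⟨_, _, .inr (.inr (.inr ⟨rfl, rfl, h⟩))⟩]
  let r : L.Site → ℤ → ℤ → ℕ → L.Site := fun b d e k => ((b.1.1 + k * d, b.1.2 + k * e), b.2)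
  have hray : ∀ {b : L.Site} {d e : ℤ}, (d = 1 ∧ e = 0 ∧ b.1.1 = x.1.1 + n) ∨
      (d = -1 ∧ e = 0 ∧ b.1.1 = x.1.1 - n) ∨ (d = 0 ∧ e = 1 ∧ b.1.2 = x.1.2 + n) ∨
      (d = 0 ∧ e = -1 ∧ b.1.2 = x.1.2 - n) →
      IsRay (r b d e) ∧ r b d e 0 = b ∧ ∀ k, r b d e (k + 1) ∉ box x n := by
    intro b d e hd
    refine ⟨⟨?_, ?_⟩, by simp [r], ?_⟩
    · intro k l h
      have h := congrArg Prod.fst h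
      simp only [r, Prod.mk.injEq] at h
      rcases hd with ⟨rfl, rfl, h1⟩ | ⟨rfl, rfl, h1⟩ | ⟨rfl, rfl, h1⟩ | ⟨rfl, rfl, h1⟩ <;> omega
    · intro k l
      cases L
      case hexagonal => exact absurd rfl hL
      all_goals
        simp only [r, adj_square_iff, adj_triangular_iff]
        rcases hd with ⟨rfl, rfl, h1⟩ | ⟨rfl, rfl, h1⟩ | ⟨rfl, rfl, h1⟩ | ⟨rfl, rfl, h1⟩ <;> omega
    · intro k
      simp only [r, box, Set.mem_ofPred_eq]
      rcases hd with ⟨rfl, rfl, h1⟩ | ⟨rfl, rfl, h1⟩ | ⟨rfl, rfl, h1⟩ | ⟨rfl, rfl, h1⟩ <;>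
        push_cast <;> omega
  obtain ⟨d, e, hd⟩ := side hb hc hbc
  obtain ⟨d', e', hd'⟩ := side hb' hc' hbc'
  obtain ⟨h1, h2, h3⟩ := hray hd
  obtain ⟨h1', h2', h3'⟩ := hray hd'
  simp only [box, Set.mem_ofPred_eq] at hb hb'
  refine ⟨r b d e, r b' d' e', h1, h1', h2, h2', h3, h3', ?_, ?_⟩
  · intro k l h
    have h := congrArg Prod.fst h
    cases L
    case hexagonal => exact absurd rfl hL
    all_goals
      simp only [adj_square_iff, adj_triangular_iff] at hadj
      simp only [r, Prod.mk.injEq] at h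
      rcases hd with ⟨rfl, rfl, h1⟩ | ⟨rfl, rfl, h1⟩ | ⟨rfl, rfl, h1⟩ | ⟨rfl, rfl, h1⟩ <;>
        rcases hd' with ⟨rfl, rfl, h2⟩ | ⟨rfl, rfl, h2⟩ | ⟨rfl, rfl, h2⟩ | ⟨rfl, rfl, h2⟩ <;> omega
  · intro k l
    cases L
    case hexagonal => exact absurd rfl hL
    all_goals
      simp only [adj_square_iff, adj_triangular_iff] at hadj
      simp only [r, adj_square_iff, adj_triangular_iff]
      rcases hd with ⟨rfl, rfl, h1⟩ | ⟨rfl, rfl, h1⟩ | ⟨rfl, rfl, h1⟩ | ⟨rfl, rfl, h1⟩ <;>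
        rcases hd' with ⟨rfl, rfl, h2⟩ | ⟨rfl, rfl, h2⟩ | ⟨rfl, rfl, h2⟩ | ⟨rfl, rfl, h2⟩ <;> omega

/-- The zigzag from the site `b` of the hexagonal lattice in the direction `(d, e)`, in cell
coordinates. If `i = 1` then it is moved to the neighbouring row on its second step. -/
def zigzag (b : hexagonal.Site) (d e i : ℤ) (k : ℕ) : hexagonal.Site :=
  ((b.1.1 + ((k + 1) / 2 : ℕ) * d - (min (k / 2) 1 : ℕ) * (i * e),
    b.1.2 + ((k + 1) / 2 : ℕ) * e - (min (k / 2) 1 : ℕ) * (i * d)),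
    ⟨(b.2 + k) % 2, Nat.mod_lt _ two_pos⟩)

lemma zigzag_zero (b : hexagonal.Site) (d e i : ℤ) : zigzag b d e i 0 = b := by
  have := type_hexagonal b
  apply site_ext <;> simp [zigzag]
  omega

/-- After `k` steps a zigzag has advanced by `u` cells in its direction, and by `m * i` cells
sideways. The number `u` grows at every second step, as the steps along a row alternate between
changing the cell and changing the type only. -/
lemma zigzag_coord (b : hexagonal.Site) (d e i : ℤ) (k : ℕ) : ∃ u m : ℤ,
    (zigzag b d e i k).1.1 = b.1.1 + u * d - m * (i * e) ∧
    (zigzag b d e i k).1.2 = b.1.2 + u * e - m * (i * d) ∧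
    ((b.2 : ℕ) = 1 → (k : ℤ) + 1 = 2 * u + (zigzag b d e i k).2) ∧
    ((b.2 : ℕ) = 0 → (k : ℤ) = 2 * u - (zigzag b d e i k).2) ∧
    ((k ≤ 1 ∧ m = 0) ∨ (2 ≤ k ∧ m = 1)) := by
  refine ⟨((k + 1) / 2 : ℕ), (min (k / 2) 1 : ℕ), rfl, rfl, ?_, ?_, by omega⟩ <;>
    simp only [zigzag] <;> omega

/-- From a site of type `1` a zigzag may leave in the positive directions, and from a site of type
`0` in the negative directions. -/
def IsExit (b : hexagonal.Site) (d e : ℤ) : Prop :=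
  (d = 1 ∧ e = 0 ∧ (b.2 : ℕ) = 1) ∨ (d = -1 ∧ e = 0 ∧ (b.2 : ℕ) = 0) ∨
    (d = 0 ∧ e = 1 ∧ (b.2 : ℕ) = 1) ∨ (d = 0 ∧ e = -1 ∧ (b.2 : ℕ) = 0)

lemma isRay_zigzag {b : hexagonal.Site} {d e i : ℤ} (hi : i = 0 ∨ i = 1) (hd : IsExit b d e) :
    IsRay (zigzag b d e i) := by
  have hcoord := zigzag_coord b d e i
  have hlt := fun k => type_hexagonal (zigzag b d e i k)
  -- Along a zigzag, a suitable linear function of the coordinates and of the type counts the steps.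
  constructor
  · intro k l h
    obtain ⟨u, m, hu1, hu2, hu3, hu4, hu5⟩ := hcoord k
    obtain ⟨v, m', hv1, hv2, hv3, hv4, hv5⟩ := hcoord l
    rw [h] at hu1 hu2 hu3 hu4
    generalize zigzag b d e i l = y at *
    rcases hi with rfl | rfl <;>
      rcases hd with ⟨rfl, rfl, h1⟩ | ⟨rfl, rfl, h1⟩ | ⟨rfl, rfl, h1⟩ | ⟨rfl, rfl, h1⟩ <;> omega
  · intro k l
    rw [adj_hexagonal_iff]
    obtain ⟨u, m, hu1, hu2, hu3, hu4, hu5⟩ := hcoord k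
    obtain ⟨v, m', hv1, hv2, hv3, hv4, hv5⟩ := hcoord l
    have hy := hlt k
    have hy' := hlt l
    generalize zigzag b d e i k = y at *
    generalize zigzag b d e i l = y' at *
    clear hcoord hlt
    generalize (y.2 : ℕ) = s at *
    generalize (y'.2 : ℕ) = s' at *
    rw [hu1, hu2, hv1, hv2]
    clear hu1 hu2 hv1 hv2
    rcases hd with ⟨rfl, rfl, h1⟩ | ⟨rfl, rfl, h1⟩ | ⟨rfl, rfl, h1⟩ | ⟨rfl, rfl, h1⟩ <;>
      simp only [h1, true_imp_iff, zero_ne_one, one_ne_zero, false_imp_iff] at hu3 hu4 hv3 hv4 <;>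
      rcases hi with rfl | rfl <;>
      rcases hu5 with ⟨hu5, rfl⟩ | ⟨hu5, rfl⟩ <;> rcases hv5 with ⟨hv5, rfl⟩ | ⟨hv5, rfl⟩ <;>
      interval_cases s <;> interval_cases s' <;> simp <;> omega

/-- The site `b` lies on the side of the box from which the direction `(d, e)` points outwards. -/
def IsOnSide (x : hexagonal.Site) (n : ℕ) (b : hexagonal.Site) (d e : ℤ) : Prop :=
  (d = 1 → b.1.1 = x.1.1 + n) ∧ (d = -1 → b.1.1 = x.1.1 - n) ∧
    (e = 1 → b.1.2 = x.1.2 + n) ∧ (e = -1 → b.1.2 = x.1.2 - n)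

lemma exists_isExit {x b c : hexagonal.Site} {n : ℕ} (hb : b ∈ box x n) (hc : c ∉ box x n)
    (h : hexagonal.graph.Adj b c) : ∃ d e, IsExit b d e ∧ IsOnSide x n b d e := by
  rw [adj_hexagonal_iff] at h
  simp only [box, Set.mem_ofPred_eq] at hb hc
  have : ((b.2 : ℕ) = 1 ∧ b.1.1 = x.1.1 + n) ∨ ((b.2 : ℕ) = 0 ∧ b.1.1 = x.1.1 - n) ∨
      ((b.2 : ℕ) = 1 ∧ b.1.2 = x.1.2 + n) ∨ ((b.2 : ℕ) = 0 ∧ b.1.2 = x.1.2 - n) := by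
    omega
  rcases this with h | h | h | h
  · exact ⟨1, 0, .inl ⟨rfl, rfl, h.1⟩, by simp [IsOnSide, h.2]⟩
  · exact ⟨-1, 0, .inr (.inl ⟨rfl, rfl, h.1⟩), by simp [IsOnSide, h.2]⟩
  · exact ⟨0, 1, .inr (.inr (.inl ⟨rfl, rfl, h.1⟩)), by simp [IsOnSide, h.2]⟩
  · exact ⟨0, -1, .inr (.inr (.inr ⟨rfl, rfl, h.1⟩)), by simp [IsOnSide, h.2]⟩

lemma zigzag_notMem_box {x b : hexagonal.Site} {n : ℕ} {d e i : ℤ} (hi : i = 0 ∨ i = 1)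
    (hd : IsExit b d e) (hs : IsOnSide x n b d e) (k : ℕ) : zigzag b d e i (k + 1) ∉ box x n := by
  obtain ⟨u, m, hu1, hu2, hu3, hu4, hu5⟩ := zigzag_coord b d e i (k + 1)
  have hy := type_hexagonal (zigzag b d e i (k + 1))
  simp only [box, Set.mem_ofPred_eq]
  generalize zigzag b d e i (k + 1) = y at *
  rcases hi with rfl | rfl <;>
    rcases hd with ⟨rfl, rfl, h1⟩ | ⟨rfl, rfl, h1⟩ | ⟨rfl, rfl, h1⟩ | ⟨rfl, rfl, h1⟩ <;>
    simp [IsOnSide] at hs <;> omega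

set_option maxHeartbeats 2000000 in
/-- On the hexagonal lattice, the two rays are zigzags. Zigzags in neighbouring rows touch, so if
both rays start from the same side of the box, then one of them is moved to the next row on its
second step, away from the other one. -/
lemma exists_escape_hexagonal (x : hexagonal.Site) (n : ℕ)
    {b b' c c' : hexagonal.Site} (hb : b ∈ box x n) (hb' : b' ∈ box x n) (hc : c ∉ box x n)
    (hc' : c' ∉ box x n) (hbc : hexagonal.graph.Adj b c) (hbc' : hexagonal.graph.Adj b' c')
    (hne : b ≠ b') (hadj : ¬ hexagonal.graph.Adj b b') :
    ∃ r r', IsEscape (box x n) b b' r r' := by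
  obtain ⟨d, e, hd, hs⟩ := exists_isExit hb hc hbc
  obtain ⟨d', e', hd', hs'⟩ := exists_isExit hb' hc' hbc'
  have hne' : ¬ (b.1.1 = b'.1.1 ∧ b.1.2 = b'.1.2 ∧ (b.2 : ℕ) = b'.2) := fun h =>
    hne (site_ext h.1 h.2.1 h.2.2)
  -- The ray to be moved is the one which starts further on the side towards which it is moved.
  obtain ⟨i, i', hi, hi', hii⟩ : ∃ i i' : ℤ, (i = 0 ∨ i = 1) ∧ (i' = 0 ∨ i' = 1) ∧
      if d = d' ∧ e = e' then
        i + i' = 1 ∧ (i = 1 ↔ d * (b.1.2 - b'.1.2) + e * (b.1.1 - b'.1.1) < 0)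
      else i = 0 ∧ i' = 0 := by
    by_cases h : d = d' ∧ e = e'
    · simp only [h, and_self, if_true]
      by_cases h' : d' * (b.1.2 - b'.1.2) + e' * (b.1.1 - b'.1.1) < 0
      · exact ⟨1, 0, by omega, by omega, by omega, by simp [h']⟩
      · exact ⟨0, 1, by omega, by omega, by omega, by simp [h']⟩
    · exact ⟨0, 0, by omega, by omega, by simp [h]⟩
  have apart : ∀ k l, ¬ (zigzag b d e i k = zigzag b' d' e' i' l ∨
      hexagonal.graph.Adj (zigzag b d e i k) (zigzag b' d' e' i' l)) := by
    intro k l h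
    have hb3 := type_hexagonal b
    have hb3' := type_hexagonal b'
    obtain ⟨u, m, hu1, hu2, hu3, hu4, hu5⟩ := zigzag_coord b d e i k
    obtain ⟨v, m', hv1, hv2, hv3, hv4, hv5⟩ := zigzag_coord b' d' e' i' l
    have hy := type_hexagonal (zigzag b d e i k)
    have hy' := type_hexagonal (zigzag b' d' e' i' l)
    generalize zigzag b d e i k = y at *
    generalize zigzag b' d' e' i' l = y' at *
    replace h : (y.1.1 = y'.1.1 ∧ y.1.2 = y'.1.2 ∧ (y.2 : ℕ) = y'.2) ∨ hexagonal.graph.Adj y y' :=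
      h.imp_left (by rintro rfl; simp)
    rw [adj_hexagonal_iff] at h hadj
    rw [hu1, hu2, hv1, hv2] at h
    clear hu1 hu2 hv1 hv2 hbc hbc' hc hc' hne
    simp only [box, Set.mem_ofPred_eq] at hb hb'
    obtain ⟨⟨b1, b2⟩, b3⟩ := b
    obtain ⟨⟨b1', b2'⟩, b3'⟩ := b'
    obtain ⟨⟨x1, x2⟩, x3⟩ := x
    obtain ⟨⟨y1, y2⟩, y3⟩ := y
    obtain ⟨⟨y1', y2'⟩, y3'⟩ := y'
    simp only [IsExit, IsOnSide] at *
    generalize (b3 : ℕ) = s at *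
    generalize (b3' : ℕ) = s' at *
    generalize (y3 : ℕ) = t at *
    generalize (y3' : ℕ) = t' at *
    rcases hd with ⟨rfl, rfl, rfl⟩ | ⟨rfl, rfl, rfl⟩ | ⟨rfl, rfl, rfl⟩ | ⟨rfl, rfl, rfl⟩ <;>
      rcases hd' with ⟨rfl, rfl, rfl⟩ | ⟨rfl, rfl, rfl⟩ | ⟨rfl, rfl, rfl⟩ | ⟨rfl, rfl, rfl⟩ <;>
      simp at hs hs' hii hu3 hu4 hv3 hv4 hadj hne' <;>
      rcases hu5 with ⟨hu5, rfl⟩ | ⟨hu5, rfl⟩ <;> rcases hv5 with ⟨hv5, rfl⟩ | ⟨hv5, rfl⟩ <;>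
      rcases h with h | ⟨h5, h6, h7⟩ | ⟨h5, h6, h7⟩ <;> omega
  exact ⟨_, _, isRay_zigzag hi hd, isRay_zigzag hi' hd', zigzag_zero _ _ _ _, zigzag_zero _ _ _ _,
    zigzag_notMem_box hi hd hs, zigzag_notMem_box hi' hd' hs',
    fun k l h => apart k l (.inl h), fun k l h => apart k l (.inr h)⟩

/-- From two sites of a box which have neighbours outside the box and which are distinct and not
adjacent, one can escape to infinity along rays which do not meet or touch. -/
lemma exists_escape {L : PlanarLattice} (x : L.Site) (n : ℕ) {b b' c c' : L.Site}
    (hb : b ∈ box x n) (hb' : b' ∈ box x n) (hc : c ∉ box x n) (hc' : c' ∉ box x n)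
    (hbc : L.graph.Adj b c) (hbc' : L.graph.Adj b' c') (hne : b ≠ b')
    (hadj : ¬ L.graph.Adj b b') : ∃ r r', IsEscape (box x n) b b' r r' := by
  cases L
  case hexagonal => exact exists_escape_hexagonal x n hb hb' hc hc' hbc hbc' hne hadj
  all_goals exact exists_escape_of_ne_hexagonal (by simp) x n hb hb' hc hc' hbc hbc' hne hadj

/-! ### Clusters -/

lemma mem_cluster_self {ω : Set L.Site} {x : L.Site} (hx : x ∈ ω) : x ∈ cluster ω x :=
  ⟨.nil, by simpa using hx⟩

lemma left_mem_of_mem_cluster {ω : Set L.Site} {x y : L.Site} (h : y ∈ cluster ω x) : x ∈ ω := by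
  obtain ⟨w, hw⟩ := h
  exact hw _ w.start_mem_support

lemma cluster_subset (ω : Set L.Site) (x : L.Site) : cluster ω x ⊆ ω := by
  rintro y ⟨w, hw⟩
  exact hw _ w.end_mem_support

lemma mem_cluster_symm {ω : Set L.Site} {x y : L.Site} (h : y ∈ cluster ω x) :
    x ∈ cluster ω y := by
  obtain ⟨w, hw⟩ := h
  exact ⟨w.reverse, fun z hz => hw z (by simpa using hz)⟩

lemma mem_cluster_trans {ω : Set L.Site} {x y z : L.Site} (h : y ∈ cluster ω x)
    (h' : z ∈ cluster ω y) : z ∈ cluster ω x := by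
  obtain ⟨w, hw⟩ := h
  obtain ⟨w', hw'⟩ := h'
  refine ⟨w.append w', fun a ha => ?_⟩
  rw [SimpleGraph.Walk.mem_support_append_iff] at ha
  exact ha.elim (hw a) (hw' a)

lemma mem_cluster_of_adj {ω : Set L.Site} {x y : L.Site} (hx : x ∈ ω) (hy : y ∈ ω)
    (h : L.graph.Adj x y) : y ∈ cluster ω x :=
  ⟨h.toWalk, by simp [hx, hy]⟩

lemma mem_cluster_step {ω : Set L.Site} {x y z : L.Site} (h : y ∈ cluster ω x) (hz : z ∈ ω)
    (ha : L.graph.Adj y z) : z ∈ cluster ω x :=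
  mem_cluster_trans h (mem_cluster_of_adj (cluster_subset _ _ h) hz ha)

lemma cluster_mono {ω ω' : Set L.Site} (h : ω ⊆ ω') (x : L.Site) :
    cluster ω x ⊆ cluster ω' x := by
  rintro y ⟨w, hw⟩
  exact ⟨w, fun z hz => h (hw z hz)⟩

/-- A set containing `x` and closed under passing to open neighbours contains the cluster. -/
lemma cluster_subset_of_closed {ω K : Set L.Site} {x : L.Site} (hx : x ∈ K)
    (hK : ∀ z ∈ K, ∀ z' ∈ ω, L.graph.Adj z z' → z' ∈ K) : cluster ω x ⊆ K := by
  rintro y ⟨w, hw⟩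
  induction w with
  | nil => exact hx
  | cons h w ih =>
    exact ih (hK _ hx _ (hw _ (by simp)) h) fun z hz => hw z (by simp [hz])

/-! ### Doubly-infinite paths through a box -/

/-- The sites of `D` all of whose neighbours are in `D`. -/
def inner (D : Set L.Site) : Set L.Site := {z ∈ D | ∀ c, L.graph.Adj z c → c ∈ D}

lemma box_subset_inner (x : L.Site) (n : ℕ) : box x n ⊆ inner (box x (n + 1)) :=
  fun _ hz => ⟨box_mono x (by omega) hz, fun _ hc => mem_box_trans hz (mem_box_one_of_adj hc)⟩

/-- A doubly-infinite path cannot stay in a finite set together with a ray which is attached to the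
finite set only by its first site: the path would have to use up the ray in one direction, and
then nothing is left for the other direction. -/
lemma not_path_in_finite_union_ray {F : Set L.Site} (hF : F.Finite) {r : ℕ → L.Site} (hr : IsRay r)
    (hadj : ∀ k, ∀ z ∈ F, ¬ L.graph.Adj (r (k + 1)) z) {γ : ℤ → L.Site}
    (hγ : Function.Injective γ) (hγadj : ∀ m n, L.graph.Adj (γ m) (γ n) ↔ |m - n| = 1)
    (hmem : ∀ n, γ n ∈ F ∪ Set.range r) : False := by
  obtain ⟨n, k, hn⟩ : ∃ n k, γ n = r (k + 1) := by
    by_contra! h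
    refine Set.infinite_univ (α := ℤ) (Set.Finite.of_finite_image (f := γ) ?_ hγ.injOn)
    refine (hF.union (Set.finite_singleton (r 0))).subset ?_
    rintro _ ⟨n, -, rfl⟩
    rcases hmem n with h' | ⟨k, hk⟩
    · exact .inl h'
    · cases k with
      | zero => exact .inr hk.symm
      | succ k => exact absurd hk.symm (h n k)
  -- The main case: after time `n` the path follows the ray to infinity.
  have main : ∀ {γ : ℤ → L.Site}, Function.Injective γ →
      (∀ m n, L.graph.Adj (γ m) (γ n) ↔ |m - n| = 1) → (∀ n, γ n ∈ F ∪ Set.range r) →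
      ∀ {n k}, γ n = r (k + 1) → γ (n + 1) = r (k + 2) → False := by
    intro γ hγ hγadj hmem n k h0 h1
    have hnext : ∀ j : ℕ, γ (n + j) = r (k + 1 + j) ∧ γ (n + j + 1) = r (k + 2 + j) := by
      intro j
      induction j with
      | zero => simpa using ⟨h0, h1⟩
      | succ j ih =>
        have e : n + ((j + 1 : ℕ) : ℤ) = n + j + 1 := by push_cast; ring
        refine ⟨by rw [e, ih.2]; congr 1; omega, ?_⟩
        rw [e]
        have ha : L.graph.Adj (r (k + 1 + j + 1)) (γ (n + j + 1 + 1)) := by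
          rw [show k + 1 + j + 1 = k + 2 + j by omega, ← ih.2, hγadj]
          rw [show n + j + 1 - (n + j + 1 + 1) = -1 by ring]; rfl
        rcases hmem (n + j + 1 + 1) with h | ⟨l, hl⟩
        · exact absurd ha (hadj _ _ h)
        · rw [← hl, hr.adj_iff] at ha
          rcases ha with ha | ha
          · exfalso
            have : γ (n + j + 1 + 1) = γ (n + j) := by
              rw [← hl, ih.1]; congr 1; omega
            have := hγ this
            omega
          · rw [← hl]; congr 1; omega
    refine Set.infinite_univ (α := ℕ) (Set.Finite.of_finite_image
      (f := fun j : ℕ => γ (n - 1 - j)) ?_ ?_)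
    · refine (hF.union ((Set.finite_Iic k).image r)).subset ?_
      rintro _ ⟨j, -, rfl⟩
      rcases hmem (n - 1 - j) with h | ⟨l, hl⟩
      · exact .inl h
      · refine .inr ⟨l, ?_, hl⟩
        by_contra hlk
        simp only [Set.mem_Iic, not_le] at hlk
        have h2 := (hnext (l - (k + 1))).1
        rw [show k + 1 + (l - (k + 1)) = l by omega, hl] at h2
        have := hγ h2
        omega
    · intro i _ j _ hij
      have := hγ hij
      omega
  have hnb : ∀ m, |n - m| = 1 → γ m = r k ∨ γ m = r (k + 2) := by
    intro m hm
    have ha := (hγadj n m).2 hm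
    rw [hn] at ha
    rcases hmem m with h | ⟨l, hl⟩
    · exact absurd ha (hadj _ _ h)
    · rw [← hl, hr.adj_iff] at ha
      rw [← hl]
      rcases ha with ha | ha
      · left; congr 1; omega
      · right; congr 1
  rcases hnb (n + 1) (by rw [show n - (n + 1) = -1 by ring]; rfl) with h1 | h1
  · rcases hnb (n - 1) (by rw [show n - (n - 1) = 1 by ring]; rfl) with h2 | h2
    · have := hγ (h1.trans h2.symm)
      omega
    · refine main (γ := fun i => γ (-i)) (hγ.comp neg_injective) ?_ (fun i => hmem _)
        (n := -n) (k := k) (by simpa using hn) ?_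
      · intro a c
        rw [hγadj, show -a - -c = -(a - c) by ring, abs_neg]
      · rw [← h2]; congr 1; ring
  · exact main hγ hγadj hmem hn h1

/-- Let `b` and `b'` be sites of the finite set `D` which are not connected in `ω`. Two rays
escaping from `D` at `b` and `b'`, together with the open sites in the interior of `D`, contain no
doubly-infinite path. -/
lemma not_hasDoublyInfinitePath_of_escape {D ω : Set L.Site} (hD : D.Finite) {b b' : L.Site}
    {r r' : ℕ → L.Site} (he : IsEscape D b b' r r') (hb : b ∈ ω) (hb' : b' ∈ ω)
    (hnot : b' ∉ cluster ω b) :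
    ¬ HasDoublyInfinitePath (ω ∩ inner D ∪ Set.range r ∪ Set.range r') := by
  rintro ⟨γ, hγ, hmem, hγadj⟩
  have hF : (inner D).Finite := hD.subset fun z hz => hz.1
  have hadj : ∀ k, ∀ z ∈ inner D, ¬ L.graph.Adj (r (k + 1)) z :=
    fun k z hz h => he.notMem k (hz.2 _ h.symm)
  have hadj' : ∀ k, ∀ z ∈ inner D, ¬ L.graph.Adj (r' (k + 1)) z :=
    fun k z hz h => he.notMem' k (hz.2 _ h.symm)
  -- The component of `b`.
  let K : Set L.Site := Set.range r ∪ (inner D ∩ cluster ω b)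
  have hK : ∀ z ∈ K, ∀ z' ∈ ω ∩ inner D ∪ Set.range r ∪ Set.range r', L.graph.Adj z z' →
      z' ∈ K := by
    rintro z (⟨k, rfl⟩ | ⟨hz, hzb⟩) z' ((hz' | hz') | ⟨l, rfl⟩) ha
    · cases k with
      | succ k => exact absurd ha (hadj k z' hz'.2)
      | zero =>
        rw [he.zero] at ha
        exact .inr ⟨hz'.2, mem_cluster_of_adj hb hz'.1 ha⟩
    · exact .inl hz'
    · exact absurd ha (he.not_adj k l)
    · exact .inr ⟨hz'.2, mem_cluster_step hzb hz'.1 ha⟩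
    · exact .inl hz'
    · cases l with
      | succ l => exact absurd ha.symm (hadj' l z hz)
      | zero =>
        rw [he.zero'] at ha
        exact absurd (mem_cluster_step hzb hb' ha) hnot
  have hiff : ∀ n, γ n ∈ K ↔ γ (n + 1) ∈ K := by
    intro n
    have ha : L.graph.Adj (γ n) (γ (n + 1)) := by
      rw [hγadj, show n - (n + 1) = -1 by ring]; rfl
    exact ⟨fun h => hK _ h _ (hmem _) ha, fun h => hK _ h _ (hmem _) ha.symm⟩
  have hall : ∀ n, γ n ∈ K ↔ γ 0 ∈ K := by
    intro n
    induction n with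
    | zero => rfl
    | succ n ih => rw [← hiff, ih]
    | pred n ih => rw [hiff, sub_add_cancel, ih]
  by_cases h0 : γ 0 ∈ K
  · refine not_path_in_finite_union_ray hF he.isRay hadj hγ hγadj fun n => ?_
    rcases (hall n).2 h0 with h | h
    · exact .inr h
    · exact .inl h.1
  · refine not_path_in_finite_union_ray hF he.isRay' hadj' hγ hγadj fun n => ?_
    rcases hmem n with (h | h) | h
    · exact .inl h.2
    · exact absurd ((hall n).1 (.inl h)) h0
    · exact .inr h

/-- If two sites are connected in `Y` then a shortest path between them is a sequence whose
`i`-th site is at distance `i` from the first, so that only consecutive sites are adjacent. -/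
lemma exists_geodesic {Y : Set L.Site} {b b' : L.Site} (h : b' ∈ cluster Y b) :
    ∃ (ℓ : ℕ) (q : ℕ → L.Site), q 0 = b ∧ q ℓ = b' ∧ (∀ i, q i ∈ Y) ∧
      ∀ i j, i < j → j ≤ ℓ → q i ≠ q j ∧ (L.graph.Adj (q i) (q j) ↔ j = i + 1) := by
  let H : SimpleGraph L.Site :=
    { Adj := fun a c => L.graph.Adj a c ∧ a ∈ Y ∧ c ∈ Y
      symm := ⟨fun a c h => ⟨h.1.symm, h.2.2, h.2.1⟩⟩
      loopless := ⟨fun a h => h.1.ne rfl⟩ }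
  have hbY : b ∈ Y := left_mem_of_mem_cluster h
  have hreach : H.Reachable b b' := by
    obtain ⟨w, hw⟩ := h
    clear hbY
    induction w with
    | nil => rfl
    | cons h w ih =>
      have : H.Adj _ _ := ⟨h, hw _ (by simp), hw _ (by simp)⟩
      exact this.reachable.trans (ih fun z hz => hw z (by simp [hz]))
  obtain ⟨w, hw⟩ := hreach.exists_walk_length_eq_dist
  have hmem : ∀ i, w.getVert i ∈ Y := by
    intro i
    have : ∀ {a c : L.Site} (w : H.Walk a c), a ∈ Y → ∀ z ∈ w.support, z ∈ Y := by
      intro a c w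
      induction w with
      | nil => intro ha z hz; simp at hz; exact hz ▸ ha
      | cons h w ih =>
        intro ha z hz
        simp only [SimpleGraph.Walk.support_cons, List.mem_cons] at hz
        rcases hz with rfl | hz
        · exact ha
        · exact ih h.2.2 z hz
    exact this w hbY _ (w.getVert_mem_support i)
  have hdist : ∀ i ≤ w.length, H.dist b (w.getVert i) = i := by
    intro i hi
    apply le_antisymm
    · exact (SimpleGraph.dist_le (w.take i)).trans (by simp)
    · have h1 : H.dist (w.getVert i) b' ≤ w.length - i :=
        (SimpleGraph.dist_le (w.drop i)).trans (by simp)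
      have h2 : H.dist b b' ≤ H.dist b (w.getVert i) + H.dist (w.getVert i) b' :=
        SimpleGraph.Reachable.dist_triangle_left ⟨w.take i⟩ _
      omega
  refine ⟨w.length, w.getVert, by simp, by simp, hmem, fun i j hij hj => ⟨?_, ?_, ?_⟩⟩
  · intro h
    have := hdist i (by omega)
    rw [h, hdist j hj] at this
    omega
  · intro ha
    have hH : H.Adj (w.getVert i) (w.getVert j) := ⟨ha, hmem i, hmem j⟩
    have h1 := hdist i (by omega)
    have h2 := hdist j hj
    have h3 : H.dist b (w.getVert j) ≤
        H.dist b (w.getVert i) + H.dist (w.getVert i) (w.getVert j) :=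
      SimpleGraph.Reachable.dist_triangle_left ⟨w.take i⟩ _
    rw [SimpleGraph.dist_eq_one_iff_adj.2 hH] at h3
    omega
  · rintro rfl
    exact (w.adj_getVert_succ (by omega)).1

/-- A shortest path inside `D`, extended by two escaping rays, is a doubly-infinite path. -/
lemma hasDoublyInfinitePath_of_escape {D Y : Set L.Site} {b b' : L.Site}
    {r r' : ℕ → L.Site} (he : IsEscape D b b' r r') (hY : ∀ z ∈ Y, z ≠ b → z ≠ b' → z ∈ inner D)
    (hconn : b' ∈ cluster Y b) :
    HasDoublyInfinitePath (Y ∪ Set.range r ∪ Set.range r') := by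
  obtain ⟨ℓ, q, hq0, hqℓ, hqY, hq⟩ := exists_geodesic hconn
  have hℓ : 2 ≤ ℓ := by
    by_contra hlt
    have : ℓ = 0 ∨ ℓ = 1 := by omega
    rcases this with rfl | rfl
    · exact he.ne 0 0 (by rw [he.zero, he.zero', ← hq0, ← hqℓ])
    · have := ((hq 0 1 one_pos le_rfl).2).2 rfl
      rw [hq0, hqℓ, ← he.zero, ← he.zero'] at this
      exact he.not_adj 0 0 this
  have hinner : ∀ i, 0 < i → i < ℓ → q i ∈ inner D := by
    intro i h0 h1
    refine hY _ (hqY i) ?_ ?_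
    · rw [← hq0]; exact ((hq 0 i h0 h1.le).1).symm
    · rw [← hqℓ]; exact (hq i ℓ h1 le_rfl).1
  let γ : ℤ → L.Site := fun n =>
    if n ≤ 0 then r (-n).toNat else if n ≤ ℓ then q n.toNat else r' (n - ℓ).toNat
  have h1 : ∀ n : ℤ, n ≤ 0 → γ n = r (-n).toNat := fun n hn => by simp [γ, hn]
  have h2 : ∀ n : ℤ, 0 ≤ n → n ≤ ℓ → γ n = q n.toNat := by
    intro n hn hn'
    rcases hn.eq_or_lt with rfl | h
    · simp [γ, hq0, he.zero]
    · simp [γ, not_le.2 h, hn']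
  have h3 : ∀ n : ℤ, (ℓ : ℤ) ≤ n → γ n = r' (n - ℓ).toNat := by
    intro n hn
    rcases hn.eq_or_lt with rfl | h
    · have : ¬ ((ℓ : ℤ) ≤ 0) := by omega
      simp [γ, hqℓ, he.zero']
      intro h0
      omega
    · have : ¬ (n ≤ 0) := by omega
      simp [γ, not_le.2 h, this]
  have key : ∀ m n, m < n → γ m ≠ γ n ∧ (L.graph.Adj (γ m) (γ n) ↔ n = m + 1) := by
    intro m n hmn
    by_cases hn : n ≤ 0
    · rw [h1 n hn, h1 m (by omega), he.isRay.adj_iff]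
      exact ⟨fun h => by have := he.isRay.injective h; omega, by omega⟩
    by_cases hm : (ℓ : ℤ) ≤ m
    · rw [h3 m hm, h3 n (by omega), he.isRay'.adj_iff]
      exact ⟨fun h => by have := he.isRay'.injective h; omega, by omega⟩
    push Not at hn hm
    by_cases hc : 0 ≤ m ∧ n ≤ ℓ
    · rw [h2 m hc.1 hm.le, h2 n hn.le hc.2]
      have := hq m.toNat n.toNat (by omega) (by omega)
      rw [this.2]
      exact ⟨this.1, by omega⟩
    by_cases hc' : m ≤ 0 ∧ (ℓ : ℤ) ≤ n
    · rw [h1 m hc'.1, h3 n hc'.2]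
      exact ⟨he.ne _ _, iff_of_false (he.not_adj _ _) (by omega)⟩
    by_cases hm0 : m < 0
    · have hq' := hinner n.toNat (by omega) (by omega)
      obtain ⟨k, hk⟩ : ∃ k, (-m).toNat = k + 1 := ⟨(-m).toNat - 1, by omega⟩
      rw [h1 m hm0.le, h2 n hn.le (by omega), hk]
      exact ⟨fun h => he.notMem k (h ▸ hq'.1),
        iff_of_false (fun h => he.notMem k (hq'.2 _ h.symm)) (by omega)⟩
    · have hq' := hinner m.toNat (by omega) (by omega)
      obtain ⟨k, hk⟩ : ∃ k, (n - ℓ).toNat = k + 1 := ⟨(n - ℓ).toNat - 1, by omega⟩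
      rw [h2 m (by omega) hm.le, h3 n (by omega), hk]
      exact ⟨fun h => he.notMem' k (h ▸ hq'.1),
        iff_of_false (fun h => he.notMem' k (hq'.2 _ h)) (by omega)⟩
  refine ⟨γ, ?_, ?_, ?_⟩
  · intro m n h
    by_contra hne
    rcases lt_or_gt_of_ne hne with hlt | hlt
    · exact (key m n hlt).1 h
    · exact (key n m hlt).1 h.symm
  · intro n
    by_cases hn : n ≤ 0
    · rw [h1 n hn]; exact .inl (.inr ⟨_, rfl⟩)
    by_cases hn' : n ≤ ℓ
    · rw [h2 n (by omega) hn']; exact .inl (.inl (hqY _))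
    · rw [h3 n (by omega)]; exact .inr ⟨_, rfl⟩
  · intro m n
    rcases lt_trichotomy m n with h | rfl | h
    · rw [(key m n h).2, abs_of_neg (by omega)]; omega
    · simp
    · rw [SimpleGraph.adj_comm, (key n m h).2, abs_of_pos (by omega)]; omega

/-! ### Connections in the enhanced configuration -/

/-- If opening some sites `ψ` in the interior of `D` connects two sites outside `D`, then it already
connects, inside `D`, two boundary sites of `D` which were open and not connected. -/
lemma exists_boundary_pair {D ω ψ : Set L.Site} {u v : L.Site} (hψ : ψ ⊆ inner D) (hu : u ∉ D)
    (hv : v ∉ D) (h : v ∈ cluster (ω ∪ ψ) u) (hnot : v ∉ cluster ω u) :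
    ∃ b ∈ ω, ∃ b' ∈ ω, b ∈ D \ inner D ∧ b' ∈ D \ inner D ∧ b' ∉ cluster ω b ∧
      b' ∈ cluster ((ω ∩ inner D) ∪ ψ ∪ {b, b'}) b := by
  by_contra! hno
  have hin : ∀ z ∉ inner D, z ∈ ω ∪ ψ → z ∈ ω := fun z hz h => h.resolve_right fun h => hz (hψ h)
  have hinD : ∀ {z}, z ∈ inner D → z ∈ D := fun h => h.1
  -- The sites outside the interior connected to `u` in `ω`, and the sites of the interior connected
  -- to these through the interior of `D`.
  let K : Set L.Site := {z | (z ∉ inner D ∧ z ∈ cluster ω u) ∨ (z ∈ inner D ∧ ∃ b ∈ D \ inner D,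
    b ∈ cluster ω u ∧ z ∈ cluster ((ω ∩ inner D) ∪ ψ ∪ {b}) b)}
  have huω : u ∈ ω := hin u (fun h => hu h.1) (left_mem_of_mem_cluster h)
  have hvK : v ∈ K := by
    refine cluster_subset_of_closed (K := K) (.inl ⟨fun h => hu h.1, mem_cluster_self huω⟩) ?_ h
    rintro z (⟨hz, hzu⟩ | ⟨hz, b, hb, hbu, hzb⟩) z' hz' ha <;> by_cases hz'i : z' ∈ inner D
    · have hzD : z ∈ D := hz'i.2 _ ha.symm
      refine .inr ⟨hz'i, z, ⟨hzD, hz⟩, hzu, mem_cluster_of_adj (.inr rfl) (.inl ?_) ha⟩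
      exact hz'.imp_left fun h => ⟨h, hz'i⟩
    · exact .inl ⟨hz'i, mem_cluster_step hzu (hin _ hz'i hz') ha⟩
    · refine .inr ⟨hz'i, b, hb, hbu, mem_cluster_step hzb (.inl ?_) ha⟩
      exact hz'.imp_left fun h => ⟨h, hz'i⟩
    · have hz'D : z' ∈ D := hz.2 _ ha
      have hz'ω := hin _ hz'i hz'
      refine .inl ⟨hz'i, mem_cluster_trans hbu ?_⟩
      by_contra hcon
      refine hno b (cluster_subset _ _ hbu) z' hz'ω hb ⟨hz'D, hz'i⟩ hcon ?_
      refine mem_cluster_step (cluster_mono ?_ _ hzb) (.inr (.inr rfl)) ha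
      exact Set.union_subset_union_right _ (by simp)
  rcases hvK with h | h
  · exact hnot h.2
  · exact hv h.1.1

end PlanarLattice

namespace Enhancement

variable {L : PlanarLattice} {E : Enhancement L}

/-- Activating a single non-essential enhancement creates no connection between sites away from the
place of the activation. Otherwise, after replacing everything outside a box around that place by
two rays, the activation would create a doubly-infinite path. -/
lemma mem_cluster_of_mem_cluster_union (hness : ¬ E.IsEssential) {m : ℕ} {x u v : L.Site}
    (hm : ball x E.range ⊆ box x m) {ω : Set L.Site} (hu : u ∉ box x (m + 1))
    (hv : v ∉ box x (m + 1)) (h : v ∈ cluster (ω ∪ E.φ x ω) u) : v ∈ cluster ω u := by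
  by_contra hnot
  set D := box x (m + 1) with hD
  have hball : ball x E.range ⊆ inner D := hm.trans (box_subset_inner x m)
  obtain ⟨b, hb, b', hb', hbD, hb'D, hbb', hconn⟩ :=
    exists_boundary_pair ((E.local_effect x ω).trans hball) hu hv h hnot
  have hexit : ∀ {b : L.Site}, b ∈ D \ inner D → ∃ c, c ∉ D ∧ L.graph.Adj b c := by
    intro b hb
    by_contra! hno
    exact hb.2 ⟨hb.1, fun c hc => by_contra fun hcD => hno c hcD hc⟩
  obtain ⟨c, hc, hbc⟩ := hexit hbD
  obtain ⟨c', hc', hbc'⟩ := hexit hb'D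
  have hne : b ≠ b' := by
    rintro rfl
    exact hbb' (mem_cluster_self hb)
  obtain ⟨r, r', he⟩ := exists_escape x (m + 1) hbD.1 hb'D.1 hc hc' hbc hbc' hne
    fun ha => hbb' (mem_cluster_of_adj hb hb' ha)
  have hr : ∀ k, r k ∉ inner D := by
    rintro (_ | k)
    · rw [he.zero]; exact hbD.2
    · exact fun h => he.notMem k h.1
  have hr' : ∀ k, r' k ∉ inner D := by
    rintro (_ | k)
    · rw [he.zero']; exact hb'D.2
    · exact fun h => he.notMem' k h.1
  let ω' : Set L.Site := ω ∩ inner D ∪ Set.range r ∪ Set.range r'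
  have hφ : E.φ x ω' = E.φ x ω := by
    refine E.local_dep x _ _ (Set.ext fun z => and_congr_left fun hz => ?_)
    constructor
    · rintro ((h | ⟨k, rfl⟩) | ⟨k, rfl⟩)
      exacts [h.1, absurd (hball hz) (hr k), absurd (hball hz) (hr' k)]
    · exact fun h => .inl (.inl ⟨h, hball hz⟩)
  refine hness ⟨x, ω', not_hasDoublyInfinitePath_of_escape (box_finite _ _) he hb hb' hbb', ?_⟩
  rw [hφ]
  convert hasDoublyInfinitePath_of_escape he ?_ hconn using 1
  · have hb0 : b ∈ Set.range r := ⟨0, he.zero⟩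
    have hb0' : b' ∈ Set.range r' := ⟨0, he.zero'⟩
    ext z
    simp only [ω', Set.mem_union, Set.mem_insert_iff, Set.mem_singleton_iff]
    constructor
    · tauto
    · rintro ((((h | h) | (rfl | rfl)) | h) | h) <;> tauto
  · rintro z ((hz | hz) | hz) hzb hzb'
    · exact hz.2
    · exact hball (E.local_effect x ω hz)
    · rcases hz with hz | hz
      exacts [absurd hz hzb, absurd hz hzb']

lemma subset_enhanced (ω A : Set L.Site) : ω ⊆ E.enhanced ω A := Set.subset_union_left

lemma enhanced_mono (hmono : E.IsMonotonic) {ω ω' A A' : Set L.Site} (hω : ω ⊆ ω') (hA : A ⊆ A') :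
    E.enhanced ω A ⊆ E.enhanced ω' A' :=
  Set.union_subset_union hω (Set.biUnion_mono hA fun x _ => hmono x _ _ hω)

/-- The activated enhancements are applied one after the other. Those near `y` or `z` have no
effect, as the sites near `y` and `z` are open, and the others create no connection. -/
lemma mem_cluster_of_mem_cluster_enhanced_finset (hmono : E.IsMonotonic)
    (hness : ¬ E.IsEssential) {m : ℕ} (hm : ∀ x : L.Site, ball x E.range ⊆ box x m)
    {ω : Set L.Site} {y z : L.Site} (hy : box y (2 * m + 1) ⊆ ω) (hz : box z (2 * m + 1) ⊆ ω)
    (A : Finset L.Site) (h : z ∈ cluster (E.enhanced ω A) y) : z ∈ cluster ω y := by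
  classical
  induction A using Finset.induction_on with
  | empty => simpa [enhanced] using h
  | insert x A hx ih =>
    set η := E.enhanced ω A with hη
    have hωη : ω ⊆ η := subset_enhanced _ _
    have hsub : E.enhanced ω (insert x A : Finset L.Site) ⊆ η ∪ E.φ x η := by
      rintro a (ha | ha)
      · exact .inl (hωη ha)
      · simp only [Finset.coe_insert, Set.biUnion_insert] at ha
        rcases ha with ha | ha
        · exact .inr (hmono x _ _ hωη ha)
        · exact .inl (.inr ha)
    replace h := cluster_mono hsub _ h
    apply ih
    by_cases hfar : y ∉ box x (m + 1) ∧ z ∉ box x (m + 1)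
    · exact mem_cluster_of_mem_cluster_union hness (hm x) hfar.1 hfar.2 h
    · have hφ : E.φ x η ⊆ η := by
        refine (E.local_effect x η).trans (((hm x).trans fun a ha => hωη ?_))
        rw [not_and_or, not_not, not_not] at hfar
        rcases hfar with hfar | hfar
        · refine hy (box_mono y (by omega) (mem_box_trans (mem_box_comm.1 hfar) ha))
        · refine hz (box_mono z (by omega) (mem_box_trans (mem_box_comm.1 hfar) ha))
      rwa [Set.union_eq_left.2 hφ] at h

lemma exists_finset_of_mem_cluster_enhanced {ω A : Set L.Site} {y z : L.Site}
    (h : z ∈ cluster (E.enhanced ω A) y) :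
    ∃ A₀ : Finset L.Site, (A₀ : Set L.Site) ⊆ A ∧ z ∈ cluster (E.enhanced ω A₀) y := by
  classical
  obtain ⟨w, hw⟩ := h
  induction w with
  | @nil a =>
    rcases hw a (by simp) with ha | ha
    · exact ⟨∅, by simp, mem_cluster_self (.inl ha)⟩
    · obtain ⟨x, hx, hax⟩ := Set.mem_iUnion₂.1 ha
      exact ⟨{x}, by simpa using hx, mem_cluster_self (.inr (by simpa using hax))⟩
  | @cons a b c hab w ih =>
    obtain ⟨A₀, hA₀, hc⟩ := ih fun z hz => hw z (by simp [hz])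
    have hmono : ∀ {B B' : Finset L.Site}, B ⊆ B' → E.enhanced ω B ⊆ E.enhanced ω B' :=
      fun hB => Set.union_subset_union_right _ (Set.biUnion_subset_biUnion_left (by simpa using hB))
    obtain ⟨A₁, hA₁, ha⟩ : ∃ A₁ : Finset L.Site, (A₁ : Set L.Site) ⊆ A ∧ a ∈ E.enhanced ω A₁ := by
      rcases hw a (by simp) with ha | ha
      · exact ⟨∅, by simp, .inl ha⟩
      · obtain ⟨x, hx, hax⟩ := Set.mem_iUnion₂.1 ha
        exact ⟨{x}, by simpa using hx, .inr (by simpa using hax)⟩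
    refine ⟨A₀ ∪ A₁, by simp [hA₀, hA₁], ?_⟩
    have hc := cluster_mono (hmono (Finset.subset_union_left (s₂ := A₁))) _ hc
    have ha := hmono (Finset.subset_union_right (s₁ := A₀)) ha
    exact mem_cluster_trans (mem_cluster_of_adj ha (left_mem_of_mem_cluster hc) hab) hc

/-- Connections in the enhanced configuration come from connections in the initial one, up to a
bounded displacement of the endpoints. -/
theorem exists_mem_cluster_of_mem_cluster_enhanced (hmono : E.IsMonotonic)
    (hness : ¬ E.IsEssential) : ∃ R : ℕ, ∀ (ω A : Set L.Site) (y z : L.Site),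
      z ∈ cluster (E.enhanced ω A) y → z ∈ box y R ∨
        ∃ y' ∈ box y R, ∃ z' ∈ box z R, z' ∈ cluster ω y' := by
  obtain ⟨m, hm⟩ := exists_nat_ge (2 * E.range + 2)
  refine ⟨4 * m + 3, fun ω A y z h => ?_⟩
  by_contra! hno
  obtain ⟨hfar, hno⟩ := hno
  obtain ⟨A₀, -, h⟩ := exists_finset_of_mem_cluster_enhanced h
  set B := box y (2 * m + 1) with hB
  set B' := box z (2 * m + 1) with hB'
  have h := mem_cluster_of_mem_cluster_enhanced_finset hmono hness
    (fun x => ball_subset_box x _ hm) (ω := ω ∪ B ∪ B')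
    (fun a ha => .inl (.inr ha)) (fun a ha => .inr ha) A₀
    (cluster_mono (enhanced_mono hmono (fun a ha => .inl (.inl ha)) subset_rfl) _ h)
  -- The sites near `y` and those connected to a site near `y`.
  let K : Set L.Site := B ∪ {a | ∃ y' ∈ box y (4 * m + 3), a ∈ cluster ω y'}
  have hzK : z ∈ K := by
    refine cluster_subset_of_closed (K := K) (.inl (self_mem_box _ _)) ?_ h
    rintro a ha a' ((ha' | ha') | ha') hadj
    · rcases ha with ha | ⟨y', hy', hay'⟩
      · refine .inr ⟨a', ?_, mem_cluster_self ha'⟩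
        exact box_mono _ (by omega) (mem_box_trans ha (mem_box_one_of_adj hadj))
      · exact .inr ⟨y', hy', mem_cluster_step hay' ha' hadj⟩
    · exact .inl ha'
    · have haz : a ∈ box z (2 * m + 1 + 1) :=
        mem_box_trans ha' (mem_box_one_of_adj hadj.symm)
      rcases ha with ha | ⟨y', hy', hay'⟩
      · exact absurd (box_mono _ (by omega) (mem_box_trans ha (mem_box_comm.1 haz))) hfar
      · exact absurd hay' (hno y' hy' a (box_mono _ (by omega) haz))
  rcases hzK with hz | ⟨y', hy', hz⟩
  · exact hfar (box_mono _ (by omega) hz)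
  · exact hno y' hy' z (self_mem_box _ _) hz

end Enhancement

namespace PlanarLattice

variable {L : PlanarLattice}

/-! ### Boxes are connected -/

lemma exists_closer_site {x y : L.Site} {n : ℕ} (hy : y ∈ box x n) (hne : y.1 ≠ x.1) :
    ∃ y' ∈ box x n, y ∈ cluster (box x n) y' ∧
      (y'.1.1 - x.1.1).natAbs + (y'.1.2 - x.1.2).natAbs <
        (y.1.1 - x.1.1).natAbs + (y.1.2 - x.1.2).natAbs := by
  have hne' : ¬ (y.1.1 = x.1.1 ∧ y.1.2 = x.1.2) := fun h => hne (Prod.ext h.1 h.2)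
  have hy' := hy
  simp only [box, Set.mem_ofPred_eq] at hy'
  -- A unit vector leading from `y` towards the cell of `x`.
  obtain ⟨d, e, hde⟩ : ∃ d e : ℤ,
      (d = 1 ∧ e = 0 ∧ y.1.1 < x.1.1) ∨ (d = -1 ∧ e = 0 ∧ x.1.1 < y.1.1) ∨
      (d = 0 ∧ e = 1 ∧ y.1.2 < x.1.2) ∨ (d = 0 ∧ e = -1 ∧ x.1.2 < y.1.2) := by
    have : y.1.1 < x.1.1 ∨ x.1.1 < y.1.1 ∨ y.1.2 < x.1.2 ∨ x.1.2 < y.1.2 := by omega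
    rcases this with h | h | h | h
    exacts [⟨1, 0, by simp [h]⟩, ⟨-1, 0, by simp [h]⟩, ⟨0, 1, by simp [h]⟩, ⟨0, -1, by simp [h]⟩]
  have main : ∀ t : Fin L.numTypes, (((y.1.1 + d, y.1.2 + e), t) : L.Site) ∈ box x n ∧
      (y.1.1 + d - x.1.1).natAbs + (y.1.2 + e - x.1.2).natAbs <
        (y.1.1 - x.1.1).natAbs + (y.1.2 - x.1.2).natAbs := by
    intro t
    simp only [box, Set.mem_ofPred_eq]
    omega
  cases L
  case hexagonal =>
    -- The cell of `y` is joined to the next one by an edge between sites of different types.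
    obtain ⟨t, ht⟩ : ∃ t : Fin hexagonal.numTypes, (t : ℕ) = if d + e = 1 then 1 else 0 :=
      ⟨⟨if d + e = 1 then 1 else 0, by split_ifs <;> decide⟩, rfl⟩
    obtain ⟨t', ht'⟩ : ∃ t : Fin hexagonal.numTypes, (t : ℕ) = if d + e = 1 then 0 else 1 :=
      ⟨⟨if d + e = 1 then 0 else 1, by split_ifs <;> decide⟩, rfl⟩
    refine ⟨_, (main t').1, ?_, (main t').2⟩
    have hz : ((y.1, t) : hexagonal.Site) ∈ box x n := hy
    have h1 := mem_cluster_of_adj (main t').1 hz (by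
      rw [adj_hexagonal_iff]
      rcases hde with ⟨rfl, rfl, h⟩ | ⟨rfl, rfl, h⟩ | ⟨rfl, rfl, h⟩ | ⟨rfl, rfl, h⟩ <;>
        simp at ht ht' <;> simp [ht, ht'])
    by_cases hyt : (y.2 : ℕ) = t
    · rwa [show y = (y.1, t) from Prod.ext rfl (Fin.ext hyt)]
    · refine mem_cluster_step h1 hy ?_
      have := type_hexagonal y
      rw [adj_hexagonal_iff]
      simp only [and_self, true_or, and_true]
      split_ifs at ht <;> omega
  all_goals
    refine ⟨_, (main y.2).1, mem_cluster_of_adj (main y.2).1 hy ?_, (main y.2).2⟩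
    simp only [adj_square_iff, adj_triangular_iff]
    omega

lemma mem_cluster_box_center {x y : L.Site} {n : ℕ} (hy : y ∈ box x n) :
    y ∈ cluster (box x n) x := by
  induction hk : (y.1.1 - x.1.1).natAbs + (y.1.2 - x.1.2).natAbs using Nat.strong_induction_on
    generalizing y with
  | _ k ih =>
    by_cases hne : y.1 = x.1
    · by_cases heq : y = x
      · rw [heq]; exact mem_cluster_self (self_mem_box _ _)
      · refine mem_cluster_of_adj (self_mem_box _ _) hy ?_
        have ht : (y.2 : ℕ) ≠ x.2 := fun h => heq (Prod.ext hne (Fin.ext h))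
        cases L
        · rw [type_square, type_square] at ht; exact absurd rfl ht
        · rw [type_triangular, type_triangular] at ht; exact absurd rfl ht
        · have := type_hexagonal y
          have := type_hexagonal x
          rw [adj_hexagonal_iff, hne]
          omega
    · obtain ⟨y', hy', hc, hlt⟩ := exists_closer_site hy hne
      exact mem_cluster_trans (ih _ (hk ▸ hlt) hy' rfl) hc

/-! ### Measurability -/

lemma measurableSet_superset (G : Finset L.Site) :
    MeasurableSet {ω : Set L.Site | (G : Set L.Site) ⊆ ω} := by
  have : {ω : Set L.Site | (G : Set L.Site) ⊆ ω} = ⋂ a ∈ G, {ω | a ∈ ω} := by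
    ext ω; simp [Set.subset_def]
  rw [this]
  exact G.measurableSet_biInter fun a _ => measurableSet_mem a

/-- An event that holds as soon as finitely many sites, from a given family of finite sets of sites,
are open is measurable. -/
lemma measurableSet_exists_finset (Q : Finset L.Site → Prop) :
    MeasurableSet {ω : Set L.Site | ∃ G : Finset L.Site, (G : Set L.Site) ⊆ ω ∧ Q G} := by
  have : {ω : Set L.Site | ∃ G : Finset L.Site, (G : Set L.Site) ⊆ ω ∧ Q G} =
      ⋃ G ∈ {G | Q G}, {ω | (G : Set L.Site) ⊆ ω} := by
    ext ω; simp [and_comm]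
  rw [this]
  exact MeasurableSet.biUnion (Set.to_countable _) fun G _ => measurableSet_superset G

lemma mem_cluster_iff_exists_finset {ω : Set L.Site} {y z : L.Site} :
    z ∈ cluster ω y ↔ ∃ G : Finset L.Site, (G : Set L.Site) ⊆ ω ∧
      z ∈ cluster (G : Set L.Site) y := by
  classical
  constructor
  · rintro ⟨w, hw⟩
    exact ⟨w.support.toFinset, fun a ha => hw a (by simpa using ha), w,
      fun a ha => by simpa using ha⟩
  · rintro ⟨G, hG, h⟩
    exact cluster_mono hG _ h

lemma measurableSet_mem_cluster (y z : L.Site) : MeasurableSet {ω | z ∈ cluster ω y} := by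
  rw [show {ω | z ∈ cluster ω y} = _ from Set.ext fun _ => mem_cluster_iff_exists_finset]
  exact measurableSet_exists_finset _

lemma measurableSet_le_encard_cluster (y : L.Site) (n : ℕ) :
    MeasurableSet {ω | (n : ℕ∞) ≤ (cluster ω y).encard} := by
  have : {ω | (n : ℕ∞) ≤ (cluster ω y).encard} =
      ⋃ G ∈ {G : Finset L.Site | G.card = n}, ⋂ z ∈ G, {ω | z ∈ cluster ω y} := by
    ext ω
    simp only [Set.mem_ofPred_eq, Set.mem_iUnion, Set.mem_iInter, exists_prop]
    constructor
    · intro h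
      obtain ⟨t, ht, hn⟩ := Set.exists_subset_encard_eq h
      have hfin : t.Finite := Set.finite_of_encard_eq_coe hn
      refine ⟨hfin.toFinset, ?_, fun z hz => ht (by simpa using hz)⟩
      rw [hfin.encard_eq_coe_toFinset_card] at hn
      exact_mod_cast hn
    · rintro ⟨G, hG, h⟩
      rw [← hG, ← Set.encard_coe_eq_coe_finsetCard]
      exact Set.encard_le_encard h
  rw [this]
  exact MeasurableSet.biUnion (Set.to_countable _) fun G _ =>
    G.measurableSet_biInter fun z _ => measurableSet_mem_cluster y z

lemma measurableSet_infinite_cluster (y : L.Site) :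
    MeasurableSet {ω | (cluster ω y).Infinite} := by
  have : {ω | (cluster ω y).Infinite} = ⋂ n : ℕ, {ω | (n : ℕ∞) ≤ (cluster ω y).encard} := by
    ext ω
    simp only [Set.mem_ofPred_eq, Set.mem_iInter]
    rw [← Set.encard_eq_top_iff, ENat.eq_top_iff_forall_ge]
  rw [this]
  exact MeasurableSet.iInter fun n => measurableSet_le_encard_cluster y n

lemma encard_eq_tsum_indicator (s : Set L.Site) :
    (s.encard : ENNReal) = ∑' z, s.indicator (fun _ => 1) z := by
  rw [← tsum_subtype, ENNReal.tsum_set_one]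

lemma lintegral_encard_cluster (μ : Measure (Set L.Site)) (y : L.Site) :
    ∫⁻ ω, ((cluster ω y).encard : ENNReal) ∂μ = ∑' z, μ {ω | z ∈ cluster ω y} := by
  have hind : ∀ z, (fun ω => (cluster ω y).indicator (fun _ => (1 : ENNReal)) z) =
      Set.indicator {ω | z ∈ cluster ω y} 1 := by
    intro z; ext ω; simp [Set.indicator]
  simp_rw [encard_eq_tsum_indicator]
  rw [lintegral_tsum]
  · refine tsum_congr fun z => ?_
    rw [hind, lintegral_indicator_one (measurableSet_mem_cluster y z)]
  · intro z
    rw [hind]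
    exact (measurable_one.indicator (measurableSet_mem_cluster y z)).aemeasurable

end PlanarLattice

lemma Enhancement.measurable_enhanced {L : PlanarLattice} (E : Enhancement L) :
    Measurable fun c : Set L.Site × Set L.Site => E.enhanced c.1 c.2 := by
  classical
  have hφ : ∀ x z : L.Site, MeasurableSet {ω | z ∈ E.φ x ω} := by
    intro x z
    obtain ⟨m, hm⟩ := exists_nat_ge (2 * E.range + 2)
    have hfin : (ball x E.range).Finite := (box_finite x m).subset (ball_subset_box x _ hm)
    have : {ω | z ∈ E.φ x ω} = ⋃ G ∈ {G : Finset L.Site | z ∈ E.φ x G},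
        ⋂ a ∈ hfin.toFinset, {ω | a ∈ ω ↔ a ∈ G} := by
      ext ω
      simp only [Set.mem_ofPred_eq, Set.mem_iUnion, Set.mem_iInter, exists_prop,
        Set.Finite.mem_toFinset]
      constructor
      · intro h
        have hf := hfin.inter_of_right ω
        refine ⟨hf.toFinset, ?_, fun a ha => by simp [ha]⟩
        rwa [E.local_dep x _ ω]
        simp [Set.inter_assoc]
      · rintro ⟨G, hG, h⟩
        rwa [E.local_dep x ω G]
        ext a
        exact and_congr_left fun ha => h a ha
    rw [this]
    refine MeasurableSet.biUnion (Set.to_countable _) fun G _ => Finset.measurableSet_biInter _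
      fun a _ => ?_
    by_cases ha : a ∈ G
    · simpa [ha] using measurableSet_mem a
    · simp only [ha, iff_false]
      exact (measurableSet_mem a).compl
  refine measurable_set_iff.2 fun z => measurableSet_setOfPred.1 ?_
  have : {c : Set L.Site × Set L.Site | z ∈ E.enhanced c.1 c.2} =
      Prod.fst ⁻¹' {ω | z ∈ ω} ∪
        ⋃ x, (Prod.snd ⁻¹' {A | x ∈ A} ∩ Prod.fst ⁻¹' {ω | z ∈ E.φ x ω}) := by
    ext c; simp [Enhancement.enhanced]
  rw [this]
  exact (measurable_fst (measurableSet_mem z)).union (MeasurableSet.iUnion fun x =>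
    (measurable_snd (measurableSet_mem x)).inter (measurable_fst (hφ x z)))

/-! ### Opening finitely many sites -/

lemma iIndepFun_mem_setBernoulli {ι : Type*} (p : I) :
    iIndepFun (fun (i : ι) (ω : Set ι) => i ∈ ω) (setBernoulli (Set.univ : Set ι) p) := by
  rw [iIndepFun_iff_map_fun_eq_infinitePi_map measurable_set_mem]
  have h1 : Measurable fun q : ι → Prop => {i | q i} :=
    measurable_set_iff.2 fun i => measurable_pi_apply i
  have h2 : Measurable fun (ω : Set ι) (i : ι) => i ∈ ω :=
    measurable_pi_lambda _ measurable_set_mem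
  have : ∀ i : ι, (setBernoulli (Set.univ : Set ι) p).map (fun ω => i ∈ ω) =
      toNNReal p • Measure.dirac (i ∈ (Set.univ : Set ι)) +
        toNNReal (σ p) • Measure.dirac False := by
    intro i
    rw [setBernoulli_eq_map, Measure.map_map (measurable_set_mem i) h1]
    exact Measure.infinitePi_map_eval _ i
  simp_rw [this]
  rw [setBernoulli_eq_map, Measure.map_map h2 h1]
  exact Measure.map_id

lemma setBernoulli_mem {ι : Type*} (p : I) (a : ι) :
    (setBernoulli (Set.univ : Set ι) p).real {ω | a ∈ ω} = p := by
  have h1 : Measurable fun q : ι → Prop => {i | q i} :=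
    measurable_set_iff.2 fun i => measurable_pi_apply i
  have h : (setBernoulli (Set.univ : Set ι) p).map (fun ω => a ∈ ω) =
      toNNReal p • Measure.dirac (a ∈ (Set.univ : Set ι)) +
        toNNReal (σ p) • Measure.dirac False := by
    rw [setBernoulli_eq_map, Measure.map_map (measurable_set_mem a) h1]
    exact Measure.infinitePi_map_eval _ a
  have h' := Measure.map_apply (μ := setBernoulli (Set.univ : Set ι) p) (measurable_set_mem a)
    (MeasurableSet.of_discrete (s := {True}))
  rw [h] at h'
  have : (fun ω : Set ι => a ∈ ω) ⁻¹' {True} = {ω | a ∈ ω} := by ext; simp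
  rw [this] at h'
  rw [measureReal_def, ← h']
  simp

lemma setBernoulli_superset {ι : Type*} (p : I) (F : Finset ι) :
    (setBernoulli (Set.univ : Set ι) p).real {ω | (F : Set ι) ⊆ ω} = (p : ℝ) ^ F.card := by
  have h := (iIndepFun_mem_setBernoulli (ι := ι) p).measure_inter_preimage_eq_mul F
    (sets := fun _ => {True}) (fun _ _ => MeasurableSet.of_discrete)
  have h1 : (⋂ i ∈ F, (fun ω : Set ι => i ∈ ω) ⁻¹' {True}) = {ω | (F : Set ι) ⊆ ω} := by
    ext; simp [Set.subset_def]
  have h2 : ∀ i, (fun ω : Set ι => i ∈ ω) ⁻¹' {True} = {ω | i ∈ ω} := fun i => by ext; simp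
  rw [h1] at h
  simp_rw [h2] at h
  rw [measureReal_def, h, ENNReal.toReal_prod]
  simp_rw [← measureReal_def, setBernoulli_mem, Finset.prod_const]

lemma mul_setBernoulli_insert_le {ι : Type*} (p : I) (a : ι) {S : Set (Set ι)}
    (hS : MeasurableSet S) :
    (p : ℝ) * (setBernoulli (Set.univ : Set ι) p).real {ω | insert a ω ∈ S} ≤
      (setBernoulli (Set.univ : Set ι) p).real S := by
  set μ := setBernoulli (Set.univ : Set ι) p
  let m : ι → MeasurableSpace (Set ι) := fun i =>
    MeasurableSpace.comap (fun ω => i ∈ ω) inferInstance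
  have hind : Indep (⨆ i ∈ ({a} : Set ι), m i) (⨆ i ∈ ({a}ᶜ : Set ι), m i) μ :=
    indep_iSup_of_disjoint (fun i => (measurable_set_mem i).comap_le)
      ((iIndepFun_iff_iIndep _ _ _).1 (iIndepFun_mem_setBernoulli p)) disjoint_compl_right
  have h1 : MeasurableSet[⨆ i ∈ ({a} : Set ι), m i] {ω | a ∈ ω} := by
    have : MeasurableSet[m a] {ω : Set ι | a ∈ ω} :=
      ⟨{True}, MeasurableSet.of_discrete, by ext; simp⟩
    exact (le_iSup₂_of_le (f := fun i (_ : i ∈ ({a} : Set ι)) => m i) a rfl le_rfl) _ this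
  have h2 : MeasurableSet[⨆ i ∈ ({a}ᶜ : Set ι), m i] {ω | insert a ω ∈ S} := by
    have : Measurable[⨆ i ∈ ({a}ᶜ : Set ι), m i] fun ω : Set ι => insert a ω := by
      refine (@measurable_set_iff _ _ (⨆ i ∈ ({a}ᶜ : Set ι), m i) _).2 fun i => ?_
      by_cases hi : i = a
      · simp [hi]
      · simp only [Set.mem_insert_iff, hi, false_or]
        have : Measurable[m i] fun ω : Set ι => i ∈ ω := comap_measurable _
        exact this.mono
          (le_iSup₂_of_le (f := fun i (_ : i ∈ ({a}ᶜ : Set ι)) => m i) i hi le_rfl) le_rfl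
    exact this hS
  have h3 := (Indep_iff _ _ _).1 hind _ _ h1 h2
  rw [← setBernoulli_mem p a, measureReal_def, measureReal_def, ← ENNReal.toReal_mul, ← h3,
    ← measureReal_def]
  refine measureReal_mono ?_
  rintro ω ⟨h, h'⟩
  simpa [Set.insert_eq_of_mem (show a ∈ ω from h)] using h'

/-- If opening the sites of `F` makes an event occur with some probability, then it occurs anyway
with at least this probability times that of all sites of `F` being open. -/
lemma pow_mul_setBernoulli_union_le {ι : Type*} (p : I) (F : Finset ι) {S : Set (Set ι)}
    (hS : MeasurableSet S) :
    (p : ℝ) ^ F.card * (setBernoulli (Set.univ : Set ι) p).real {ω | ω ∪ (F : Set ι) ∈ S} ≤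
      (setBernoulli (Set.univ : Set ι) p).real S := by
  classical
  induction F using Finset.induction_on generalizing S with
  | empty => simp
  | insert a F ha ih =>
    have hmeas : Measurable fun ω : Set ι => insert a ω := by
      refine measurable_set_iff.2 fun i => ?_
      by_cases hi : i = a
      · simp [hi]
      · simpa [hi] using measurable_set_mem i
    have h1 := ih (hmeas hS)
    have h2 := mul_setBernoulli_insert_le p a hS
    have heq : {ω : Set ι | ω ∪ ((insert a F : Finset ι) : Set ι) ∈ S} =
        {ω | ω ∪ (F : Set ι) ∈ (fun ω : Set ι => insert a ω) ⁻¹' S} := by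
      ext ω; simp [Set.union_insert]
    rw [Finset.card_insert_of_notMem ha, pow_succ', mul_assoc, heq]
    exact (mul_le_mul_of_nonneg_left h1 p.2.1).trans h2

/-! ### Comparison of the two processes -/

section Comparison

variable {L : PlanarLattice}

instance (p : I) : IsProbabilityMeasure (indepPerc L p) := by
  unfold indepPerc; infer_instance

instance (E : Enhancement L) (s p : I) : IsProbabilityMeasure (enhancedPerc E s p) :=
  Measure.isProbabilityMeasure_map E.measurable_enhanced.aemeasurable

/-- The sites of a box, as a finite set. -/
noncomputable def boxFinset (x : L.Site) (n : ℕ) : Finset L.Site := (box_finite x n).toFinset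

lemma coe_boxFinset (x : L.Site) (n : ℕ) : (boxFinset x n : Set L.Site) = box x n := by
  simp [boxFinset]

lemma mem_boxFinset {x y : L.Site} {n : ℕ} : y ∈ boxFinset x n ↔ y ∈ box x n := by
  simp [boxFinset]

lemma card_boxFinset_le (x : L.Site) (n : ℕ) : (boxFinset x n).card ≤ (boxCode L n).card := by
  have := box_encard_le x n
  rw [← coe_boxFinset, Set.encard_coe_eq_coe_finsetCard] at this
  exact_mod_cast this

lemma boxCode_card_pos (L : PlanarLattice) (n : ℕ) : 0 < (boxCode L n).card :=
  lt_of_lt_of_le (Finset.card_pos.2 ⟨L.origin, mem_boxFinset.2 (self_mem_box _ _)⟩)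
    (card_boxFinset_le L.origin n)

/-- Moving the centre of a cluster within a box costs at most the probability that the box is
open. -/
lemma pow_mul_cluster_le (p : I) {x y : L.Site} {R : ℕ} (hy : y ∈ box x R)
    {P : Set L.Site → Prop} (hP : ∀ C C', C ⊆ C' → P C → P C')
    (hmeas : MeasurableSet {ω | P (cluster ω x)}) :
    (p : ℝ) ^ (boxCode L R).card * (indepPerc L p).real {ω | P (cluster ω y)} ≤
      (indepPerc L p).real {ω | P (cluster ω x)} := by
  refine le_trans (mul_le_mul (pow_le_pow_of_le_one p.2.1 p.2.2 (card_boxFinset_le x R))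
    (measureReal_mono ?_) measureReal_nonneg (pow_nonneg p.2.1 _))
    (pow_mul_setBernoulli_union_le p (boxFinset x R) hmeas)
  intro ω hω
  refine hP _ _ (fun z hz => ?_) hω
  rw [coe_boxFinset]
  exact mem_cluster_trans (cluster_mono Set.subset_union_right _ (mem_cluster_box_center hy))
    (cluster_mono Set.subset_union_left _ hz)

lemma pow_mul_mem_cluster_le (p : I) {x y z z' : L.Site} {R : ℕ} (hy : y ∈ box x R)
    (hz : z' ∈ box z R) :
    (p : ℝ) ^ (2 * (boxCode L R).card) * (indepPerc L p).real {ω | z' ∈ cluster ω y} ≤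
      (indepPerc L p).real {ω | z ∈ cluster ω x} := by
  have h1 : (p : ℝ) ^ (boxCode L R).card * (indepPerc L p).real {ω | z' ∈ cluster ω y} ≤
      (indepPerc L p).real {ω | z' ∈ cluster ω x} :=
    pow_mul_cluster_le p hy (P := fun C => z' ∈ C) (fun _ _ h h' => h h')
      (measurableSet_mem_cluster _ _)
  have h2 : (p : ℝ) ^ (boxCode L R).card * (indepPerc L p).real {ω | x ∈ cluster ω z'} ≤
      (indepPerc L p).real {ω | x ∈ cluster ω z} :=
    pow_mul_cluster_le p hz (P := fun C => x ∈ C) (fun _ _ h h' => h h')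
      (measurableSet_mem_cluster _ _)
  have hsymm : ∀ a c : L.Site, {ω | a ∈ cluster ω c} = {ω | c ∈ cluster ω a} := fun a c =>
    Set.ext fun ω => ⟨mem_cluster_symm, mem_cluster_symm⟩
  rw [hsymm x z', hsymm x z] at h2
  calc _ = (p : ℝ) ^ (boxCode L R).card * ((p : ℝ) ^ (boxCode L R).card *
        (indepPerc L p).real {ω | z' ∈ cluster ω y}) := by ring
    _ ≤ _ := (mul_le_mul_of_nonneg_left h1 (pow_nonneg p.2.1 _)).trans h2

lemma pow_le_mem_cluster (p : I) {x z : L.Site} {R : ℕ} (hz : z ∈ box x R) :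
    (p : ℝ) ^ (2 * (boxCode L R).card) ≤ (indepPerc L p).real {ω | z ∈ cluster ω x} := by
  have h := pow_mul_setBernoulli_union_le p (boxFinset x R) (measurableSet_mem_cluster x z)
  have huniv : {ω : Set L.Site | ω ∪ (boxFinset x R : Set L.Site) ∈ {ω | z ∈ cluster ω x}} =
      Set.univ := by
    refine Set.eq_univ_of_forall fun ω => ?_
    rw [coe_boxFinset]
    exact cluster_mono Set.subset_union_right _ (mem_cluster_box_center hz)
  rw [huniv, probReal_univ, mul_one] at h
  refine le_trans (pow_le_pow_of_le_one p.2.1 p.2.2 ?_) h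
  have := card_boxFinset_le x R
  omega

variable {E : Enhancement L}

lemma enhancedPerc_real_le {s p : I} {S T : Set (Set L.Site)} (hS : MeasurableSet S)
    (h : ∀ ω A, E.enhanced ω A ∈ S → ω ∈ T) :
    (enhancedPerc E s p).real S ≤ (indepPerc L p).real T := by
  rw [enhancedPerc, map_measureReal_apply E.measurable_enhanced hS]
  calc _ ≤ ((indepPerc L p).prod (indepPerc L s)).real (T ×ˢ Set.univ) :=
        measureReal_mono fun c hc => ⟨h c.1 c.2 hc, trivial⟩
    _ = _ := by rw [measureReal_prod_prod]; simp

lemma indepPerc_real_le {s p : I} {S T : Set (Set L.Site)} (hT : MeasurableSet T)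
    (h : ∀ ω A, ω ∈ S → E.enhanced ω A ∈ T) :
    (indepPerc L p).real S ≤ (enhancedPerc E s p).real T := by
  rw [enhancedPerc, map_measureReal_apply E.measurable_enhanced hT]
  calc _ = ((indepPerc L p).prod (indepPerc L s)).real (S ×ˢ Set.univ) := by
        rw [measureReal_prod_prod]; simp
    _ ≤ _ := measureReal_mono fun c hc => h c.1 c.2 hc.1

open Percolation

lemma theta_le_theta (s p : I) : theta (indepPerc L) p ≤ theta (enhancedPerc E s) p :=
  indepPerc_real_le (measurableSet_infinite_cluster _) fun _ _ h =>
    Set.Infinite.mono (cluster_mono (E.subset_enhanced _ _) _) h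

lemma tau_le_tau (s p : I) (x : L.Site) : tau (indepPerc L) p x ≤ tau (enhancedPerc E s) p x :=
  indepPerc_real_le (measurableSet_mem_cluster _ _) fun _ _ h =>
    cluster_mono (E.subset_enhanced _ _) _ h

lemma measure_le_encard_le (s p : I) (n : ℕ) :
    (indepPerc L p).real {ω | (n : ℕ∞) ≤ (cluster ω L.origin).encard} ≤
      (enhancedPerc E s p).real {ω | (n : ℕ∞) ≤ (cluster ω L.origin).encard} :=
  indepPerc_real_le (measurableSet_le_encard_cluster _ _) fun _ _ h =>
    le_trans h (Set.encard_le_encard (cluster_mono (E.subset_enhanced _ _) _))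

lemma chi_eq_tsum (μ : I → Measure (Set L.Site)) [∀ p, IsFiniteMeasure (μ p)] (p : I) :
    chi μ p = ∑' z, ENNReal.ofReal (tau μ p z) := by
  rw [chi, lintegral_encard_cluster]
  exact tsum_congr fun z => by rw [tau, ofReal_measureReal]

lemma chi_le_chi (s p : I) : chi (indepPerc L) p ≤ chi (enhancedPerc E s) p := by
  rw [chi_eq_tsum, chi_eq_tsum]
  exact ENNReal.tsum_le_tsum fun z => ENNReal.ofReal_le_ofReal (tau_le_tau s p z)

/-- The enhanced cluster of `x` lies in bounded neighbourhoods of `x` and of the clusters of the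
sites near `x`. -/
lemma cluster_enhanced_subset {R : ℕ} (hR : ∀ (ω A : Set L.Site) (y z : L.Site),
      z ∈ cluster (E.enhanced ω A) y → z ∈ box y R ∨
        ∃ y' ∈ box y R, ∃ z' ∈ box z R, z' ∈ cluster ω y') (ω A : Set L.Site) (x : L.Site) :
    cluster (E.enhanced ω A) x ⊆
      boxFinset x R ∪ ⋃ y ∈ boxFinset x R, ⋃ z ∈ cluster ω y, boxFinset z R := by
  intro z hz
  simp only [coe_boxFinset, mem_boxFinset, Set.mem_union, Set.mem_iUnion]
  rcases hR ω A x z hz with h | ⟨y', hy', z', hz', h⟩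
  · exact .inl h
  · exact .inr ⟨y', hy', z', h, mem_box_comm.1 hz'⟩

lemma encard_biUnion_box_le {R M : ℕ} {C : Set L.Site} (hC : C.encard ≤ M) :
    (⋃ z ∈ C, (boxFinset z R : Set L.Site)).encard ≤ ((M * (boxCode L R).card : ℕ) : ℕ∞) := by
  classical
  have hfin : C.Finite := Set.finite_of_encard_le_coe hC
  have h1 : (⋃ z ∈ C, (boxFinset z R : Set L.Site)) =
      ((hfin.toFinset.biUnion fun z => boxFinset z R : Finset L.Site) : Set L.Site) := by
    ext; simp
  rw [h1, Set.encard_coe_eq_coe_finsetCard]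
  rw [hfin.encard_eq_coe_toFinset_card] at hC
  norm_cast at hC ⊢
  exact (Finset.card_biUnion_le_card_mul _ _ _ fun z _ => card_boxFinset_le z R).trans
    (Nat.mul_le_mul_right _ hC)

lemma encard_cluster_enhanced_le {R : ℕ} (hR : ∀ (ω A : Set L.Site) (y z : L.Site),
      z ∈ cluster (E.enhanced ω A) y → z ∈ box y R ∨
        ∃ y' ∈ box y R, ∃ z' ∈ box z R, z' ∈ cluster ω y') (ω A : Set L.Site) (x : L.Site) {M : ℕ}
    (hM : ∀ y ∈ box x R, (cluster ω y).encard ≤ M) :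
    (cluster (E.enhanced ω A) x).encard ≤
      (((boxCode L R).card + (boxCode L R).card * (M * (boxCode L R).card) : ℕ) : ℕ∞) := by
  classical
  have hfin : ∀ y ∈ boxFinset x R, (⋃ z ∈ cluster ω y, (boxFinset z R : Set L.Site)).Finite :=
    fun y hy => Set.finite_of_encard_le_coe (encard_biUnion_box_le (hM y (mem_boxFinset.1 hy)))
  let G : Finset L.Site := boxFinset x R ∪ (boxFinset x R).attach.biUnion
    fun y => (hfin y.1 y.2).toFinset
  have hG : cluster (E.enhanced ω A) x ⊆ G := by
    refine (cluster_enhanced_subset hR ω A x).trans fun z hz => ?_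
    simp only [Set.mem_union, Set.mem_iUnion] at hz
    rcases hz with hz | ⟨y, hy, hz⟩
    · exact Finset.mem_union_left _ hz
    · refine Finset.mem_union_right _ (Finset.mem_biUnion.2 ⟨⟨y, hy⟩, Finset.mem_attach _ _, ?_⟩)
      rw [Set.Finite.mem_toFinset]
      simpa using hz
  refine (Set.encard_le_encard hG).trans ?_
  rw [Set.encard_coe_eq_coe_finsetCard]
  norm_cast
  refine (Finset.card_union_le _ _).trans (Nat.add_le_add (card_boxFinset_le x R) ?_)
  refine (Finset.card_biUnion_le_card_mul _ _ (M * (boxCode L R).card) fun y _ => ?_).trans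
    (Nat.mul_le_mul_right _ (by simpa using card_boxFinset_le x R))
  have := encard_biUnion_box_le (R := R) (hM y.1 (mem_boxFinset.1 y.2))
  rw [(hfin y.1 y.2).encard_eq_coe_toFinset_card] at this
  exact_mod_cast this

/-- If an event for the enhanced process forces a monotone event for the cluster of one of the sites
near `x` then its probability is bounded by that of the event for the cluster of `x`. -/
lemma pow_mul_enhancedPerc_le (s p : I) (x : L.Site) (R : ℕ) {S : Set (Set L.Site)}
    (hS : MeasurableSet S) {P : Set L.Site → Prop} (hP : ∀ C C', C ⊆ C' → P C → P C')
    (hmeas : MeasurableSet {ω | P (cluster ω x)})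
    (h : ∀ ω A, E.enhanced ω A ∈ S → ∃ y ∈ box x R, P (cluster ω y)) :
    (p : ℝ) ^ (boxCode L R).card * (enhancedPerc E s p).real S ≤
      (boxCode L R).card * (indepPerc L p).real {ω | P (cluster ω x)} := by
  have h1 : (enhancedPerc E s p).real S ≤
      (indepPerc L p).real (⋃ y ∈ boxFinset x R, {ω | P (cluster ω y)}) := by
    refine enhancedPerc_real_le hS fun ω A hω => ?_
    obtain ⟨y, hy, hPy⟩ := h ω A hω
    exact Set.mem_biUnion (mem_boxFinset.2 hy) hPy
  calc _ ≤ (p : ℝ) ^ (boxCode L R).card *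
        ∑ y ∈ boxFinset x R, (indepPerc L p).real {ω | P (cluster ω y)} :=
        mul_le_mul_of_nonneg_left (h1.trans (measureReal_biUnion_finset_le _ _))
          (pow_nonneg p.2.1 _)
    _ ≤ ∑ y ∈ boxFinset x R, (indepPerc L p).real {ω | P (cluster ω x)} := by
        rw [Finset.mul_sum]
        exact Finset.sum_le_sum fun y hy =>
          pow_mul_cluster_le p (mem_boxFinset.1 hy) hP hmeas
    _ ≤ _ := by
        rw [Finset.sum_const, nsmul_eq_mul]
        exact mul_le_mul_of_nonneg_right (by exact_mod_cast card_boxFinset_le x R)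
          measureReal_nonneg

/-- Connectivity functions, percolation probabilities, mean cluster sizes and tails of the cluster
size of the enhanced process exceed those of the initial one by bounded factors, uniformly for `p`
away from `0`. -/
theorem exists_comparison (hmono : E.IsMonotonic) (hness : ¬ E.IsEssential) (s : I) {p₀ : ℝ}
    (hp₀ : 0 < p₀) : ∃ (C : ℝ) (D : ℕ), 1 ≤ C ∧ 0 < D ∧ ∀ p : I, p₀ ≤ p →
      theta (enhancedPerc E s) p ≤ C * theta (indepPerc L) p ∧
      (∀ x, tau (enhancedPerc E s) p x ≤ C * tau (indepPerc L) p x) ∧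
      chi (enhancedPerc E s) p ≤ ENNReal.ofReal C * chi (indepPerc L) p ∧
      ∀ n : ℕ, (enhancedPerc E s p).real {ω | (n : ℕ∞) ≤ (cluster ω L.origin).encard} ≤
        C * (indepPerc L p).real {ω | ((n / D : ℕ) : ℕ∞) ≤ (cluster ω L.origin).encard} := by
  obtain ⟨R, hR⟩ := E.exists_mem_cluster_of_mem_cluster_enhanced hmono hness
  set N := (boxCode L R).card with hN
  have hN1 : 1 ≤ N := boxCode_card_pos L R
  have hN1' : (1 : ℝ) ≤ N := by exact_mod_cast hN1
  by_cases hp1 : p₀ ≤ 1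
  swap
  · exact ⟨1, 1, le_rfl, one_pos, fun p hp => absurd (hp.trans p.2.2) hp1⟩
  set C : ℝ := N ^ 2 / p₀ ^ (2 * N) with hC
  have hpow : 0 < p₀ ^ (2 * N) := pow_pos hp₀ _
  have hpow1 : p₀ ^ (2 * N) ≤ 1 := pow_le_one₀ hp₀.le hp1
  have hC1 : 1 ≤ C := by
    rw [hC, le_div_iff₀ hpow, one_mul]
    exact hpow1.trans (one_le_pow₀ hN1')
  have hbound : ∀ {p : I}, p₀ ≤ p → ∀ {a c : ℝ}, 0 ≤ a →
      (p : ℝ) ^ (2 * N) * a ≤ N ^ 2 * c → a ≤ C * c := by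
    intro p hp a c ha h
    rw [hC, div_mul_eq_mul_div, le_div_iff₀ hpow, mul_comm]
    exact (mul_le_mul_of_nonneg_right (pow_le_pow_left₀ hp₀.le hp _) ha).trans h
  have hbound' : ∀ {p : I}, p₀ ≤ p → ∀ {a c : ℝ}, 0 ≤ a → 0 ≤ c →
      (p : ℝ) ^ N * a ≤ N * c → a ≤ C * c := by
    intro p hp a c ha hc h
    refine hbound hp ha ?_
    calc (p : ℝ) ^ (2 * N) * a ≤ (p : ℝ) ^ N * a :=
          mul_le_mul_of_nonneg_right (pow_le_pow_of_le_one p.2.1 p.2.2 (by omega)) ha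
      _ ≤ N * c := h
      _ ≤ N ^ 2 * c := mul_le_mul_of_nonneg_right (le_self_pow₀ hN1' two_ne_zero) hc
  refine ⟨C, 2 * N ^ 2, hC1, by positivity, fun p hp => ?_⟩
  have htau : ∀ x, tau (enhancedPerc E s) p x ≤ C * tau (indepPerc L) p x := by
    intro x
    refine hbound hp measureReal_nonneg ?_
    by_cases hx : x ∈ box L.origin R
    · calc _ ≤ (p : ℝ) ^ (2 * N) * 1 :=
            mul_le_mul_of_nonneg_left measureReal_le_one (pow_nonneg p.2.1 _)
        _ ≤ 1 * tau (indepPerc L) p x := by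
            rw [mul_one, one_mul]; exact pow_le_mem_cluster p hx
        _ ≤ _ := mul_le_mul_of_nonneg_right (one_le_pow₀ hN1') measureReal_nonneg
    · have h1 : tau (enhancedPerc E s) p x ≤ (indepPerc L p).real
          (⋃ c ∈ boxFinset L.origin R ×ˢ boxFinset x R, {ω | c.2 ∈ cluster ω c.1}) := by
        refine enhancedPerc_real_le (measurableSet_mem_cluster _ _) fun ω A hω => ?_
        obtain ⟨y', hy', z', hz', h⟩ := (hR ω A L.origin x hω).resolve_left hx
        exact Set.mem_biUnion (x := (y', z')) (Finset.mem_product.2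
          ⟨mem_boxFinset.2 hy', mem_boxFinset.2 hz'⟩) h
      calc _ ≤ (p : ℝ) ^ (2 * N) * ∑ c ∈ boxFinset L.origin R ×ˢ boxFinset x R,
            (indepPerc L p).real {ω | c.2 ∈ cluster ω c.1} :=
            mul_le_mul_of_nonneg_left (h1.trans (measureReal_biUnion_finset_le _ _))
              (pow_nonneg p.2.1 _)
        _ ≤ ∑ c ∈ boxFinset L.origin R ×ˢ boxFinset x R, tau (indepPerc L) p x := by
            rw [Finset.mul_sum]
            refine Finset.sum_le_sum fun c hc => ?_
            rw [Finset.mem_product, mem_boxFinset, mem_boxFinset] at hc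
            exact pow_mul_mem_cluster_le p hc.1 hc.2
        _ ≤ _ := by
            rw [Finset.sum_const, nsmul_eq_mul, Finset.card_product, sq]
            refine mul_le_mul_of_nonneg_right ?_ measureReal_nonneg
            exact_mod_cast Nat.mul_le_mul (card_boxFinset_le _ _) (card_boxFinset_le _ _)
  refine ⟨?_, htau, ?_, fun n => ?_⟩
  · refine hbound' hp measureReal_nonneg measureReal_nonneg ?_
    refine pow_mul_enhancedPerc_le s p L.origin R (measurableSet_infinite_cluster _)
      (P := Set.Infinite) (fun _ _ h h' => h'.mono h) (measurableSet_infinite_cluster _) ?_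
    intro ω A hω
    by_contra! hfin
    refine hω (Set.Finite.subset ?_ (cluster_enhanced_subset hR ω A L.origin))
    refine (Finset.finite_toSet _).union (Set.Finite.biUnion (Finset.finite_toSet _) fun y hy => ?_)
    exact Set.Finite.biUnion (hfin y (mem_boxFinset.1 hy))
      fun z _ => Finset.finite_toSet _
  · rw [chi_eq_tsum, chi_eq_tsum, ← ENNReal.tsum_mul_left]
    refine ENNReal.tsum_le_tsum fun z => ?_
    rw [← ENNReal.ofReal_mul (zero_le_one.trans hC1)]
    exact ENNReal.ofReal_le_ofReal (htau z)
  · -- Clusters of at most `M` sites around the sites near the origin leave room for at most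
    -- `N + N * (M * N) < 2 * N ^ 2 * (M + 1)` sites in the enhanced cluster.
    rcases Nat.eq_zero_or_pos (n / (2 * N ^ 2)) with h0 | hpos
    · rw [h0]
      simpa using measureReal_le_one.trans hC1
    · refine hbound' hp measureReal_nonneg measureReal_nonneg ?_
      refine pow_mul_enhancedPerc_le s p L.origin R (measurableSet_le_encard_cluster _ _)
        (P := fun C => ((n / (2 * N ^ 2) : ℕ) : ℕ∞) ≤ C.encard)
        (fun _ _ h h' => h'.trans (Set.encard_le_encard h)) (measurableSet_le_encard_cluster _ _) ?_
      intro ω A hω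
      by_contra! hlt
      obtain ⟨M, hM⟩ : ∃ M, n / (2 * N ^ 2) = M + 1 := ⟨_, (Nat.succ_pred_eq_of_pos hpos).symm⟩
      have hle : ∀ y ∈ box L.origin R, (cluster ω y).encard ≤ M := by
        intro y hy
        have := hlt y hy
        rw [hM] at this
        exact Order.le_of_lt_add_one (by exact_mod_cast this)
      have h1 := (show (n : ℕ∞) ≤ _ from hω).trans
        (encard_cluster_enhanced_le hR ω A L.origin hle)
      have h2 : n ≤ N + N * (M * N) := by exact_mod_cast h1
      have h3 : 2 * N ^ 2 * (M + 1) ≤ n := by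
        rw [← hM]; exact Nat.mul_div_le _ _
      nlinarith [Nat.mul_le_mul hN1 hN1, Nat.zero_le (M * N ^ 2), Nat.mul_le_mul_left N hN1]

end Comparison

/-! ### The critical point -/

section CriticalPoint

variable {L : PlanarLattice}

open Percolation

/-- A finite family of lists of `n + 1` distinct sites which contains the list of sites of every
path of length `n` ending at `x`. -/
noncomputable def pathLists (x : L.Site) : ℕ → Finset (List L.Site)
  | 0 => {[x]}
  | n + 1 => by
    classical
    exact (pathLists x n).biUnion fun l =>
      ((boxFinset (l.headD x) 1).filter (· ∉ l)).image fun y => y :: l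

lemma card_pathLists_le (x : L.Site) (n : ℕ) :
    (pathLists x n).card ≤ (boxCode L 1).card ^ n := by
  classical
  induction n with
  | zero => simp [pathLists]
  | succ n ih =>
    rw [pathLists, pow_succ]
    refine (Finset.card_biUnion_le_card_mul _ _ (boxCode L 1).card fun l _ => ?_).trans
      (Nat.mul_le_mul_right _ ih)
    exact Finset.card_image_le.trans ((Finset.card_filter_le _ _).trans (card_boxFinset_le _ _))

lemma nodup_and_length_of_mem_pathLists {x : L.Site} {n : ℕ} {l : List L.Site}
    (hl : l ∈ pathLists x n) : l.Nodup ∧ l.length = n + 1 := by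
  classical
  induction n generalizing l with
  | zero => simp only [pathLists, Finset.mem_singleton] at hl; simp [hl]
  | succ n ih =>
    simp only [pathLists, Finset.mem_biUnion, Finset.mem_image, Finset.mem_filter] at hl
    obtain ⟨l', hl', y, ⟨-, hy⟩, rfl⟩ := hl
    have := ih hl'
    exact ⟨List.nodup_cons.2 ⟨hy, this.1⟩, by simp [this.2]⟩

lemma support_mem_pathLists {x y : L.Site} (w : L.graph.Walk y x) (hw : w.IsPath) :
    w.support ∈ pathLists x w.length := by
  classical
  induction w with
  | nil => simp [pathLists]
  | @cons a c x hac w ih =>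
    rw [SimpleGraph.Walk.cons_isPath_iff] at hw
    simp only [SimpleGraph.Walk.length_cons, pathLists, Finset.mem_biUnion, Finset.mem_image,
      Finset.mem_filter, SimpleGraph.Walk.support_cons]
    refine ⟨w.support, ih hw.1, a, ⟨?_, hw.2⟩, rfl⟩
    have : w.support.headD x = c := by cases w <;> simp
    rw [this, mem_boxFinset]
    exact mem_box_one_of_adj hac.symm

lemma mem_box_length {x y : L.Site} (w : L.graph.Walk x y) : y ∈ box x w.length := by
  induction w with
  | nil => exact self_mem_box _ _
  | cons h w ih =>
    rw [SimpleGraph.Walk.length_cons, add_comm]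
    exact mem_box_trans (mem_box_one_of_adj h) ih

lemma exists_pathLists_of_infinite {ω : Set L.Site} {x : L.Site} (h : (cluster ω x).Infinite)
    (n : ℕ) : ∃ l ∈ pathLists x n, ∀ z ∈ l, z ∈ ω := by
  classical
  obtain ⟨z, ⟨w, hw⟩, hz⟩ := h.exists_notMem_finite (box_finite x n)
  have hlen : n ≤ w.bypass.length := by
    by_contra! hlt
    exact hz (box_mono x hlt.le (mem_box_length w.bypass))
  have hpath : ((w.bypass.take n).reverse).IsPath := (w.bypass_isPath.take n).reverse
  refine ⟨(w.bypass.take n).reverse.support, ?_, fun a ha => hw a ?_⟩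
  · have := support_mem_pathLists _ hpath
    rwa [SimpleGraph.Walk.length_reverse, SimpleGraph.Walk.take_length, min_eq_left hlen] at this
  · rw [SimpleGraph.Walk.support_reverse, List.mem_reverse] at ha
    exact w.support_bypass_subset_support ((w.bypass.isSubwalk_take n).support_subset ha)

lemma theta_le_pow (p : I) (n : ℕ) :
    theta (indepPerc L) p ≤ ((boxCode L 1).card * p) ^ n := by
  classical
  have h1 : theta (indepPerc L) p ≤ (indepPerc L p).real
      (⋃ l ∈ pathLists L.origin n, {ω | (l.toFinset : Set L.Site) ⊆ ω}) := by
    refine measureReal_mono (fun ω hω => ?_) (measure_ne_top _ _)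
    obtain ⟨l, hl, h⟩ := exists_pathLists_of_infinite hω n
    exact Set.mem_biUnion hl fun z hz => h z (by simpa using hz)
  calc _ ≤ ∑ l ∈ pathLists L.origin n, (indepPerc L p).real {ω | (l.toFinset : Set L.Site) ⊆ ω} :=
        h1.trans (measureReal_biUnion_finset_le _ _)
    _ ≤ ∑ l ∈ pathLists L.origin n, (p : ℝ) ^ n := by
        refine Finset.sum_le_sum fun l hl => ?_
        obtain ⟨hnd, hlen⟩ := nodup_and_length_of_mem_pathLists hl
        rw [indepPerc, setBernoulli_superset, List.toFinset_card_of_nodup hnd, hlen]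
        exact pow_le_pow_of_le_one p.2.1 p.2.2 (Nat.le_succ n)
    _ ≤ _ := by
        rw [Finset.sum_const, nsmul_eq_mul, mul_pow]
        exact mul_le_mul_of_nonneg_right (by exact_mod_cast card_pathLists_le _ n)
          (pow_nonneg p.2.1 _)

/-- For small `p` there is no infinite cluster, by counting paths. -/
lemma criticalPoint_pos : 0 < (criticalPoint (indepPerc L) : ℝ) := by
  set N := (boxCode L 1).card
  have hN : (1 : ℝ) ≤ N := by exact_mod_cast boxCode_card_pos L 1
  let p : I := ⟨1 / (2 * N), by positivity, by rw [div_le_one (by positivity)]; linarith⟩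
  have hp : theta (indepPerc L) p = 0 := by
    refine le_antisymm (ge_of_tendsto' (x := atTop) ?_ (theta_le_pow p)) measureReal_nonneg
    have : (N : ℝ) * (1 / (2 * N)) = 1 / 2 := by field_simp
    change Tendsto (fun n => ((N : ℝ) * (1 / (2 * N))) ^ n) atTop (𝓝 0)
    rw [this]
    exact tendsto_pow_atTop_nhds_zero_of_lt_one (by norm_num) (by norm_num)
  have h1 : p ≤ criticalPoint (indepPerc L) := le_sSup hp
  have h2 : (0 : ℝ) < p := by change (0 : ℝ) < 1 / (2 * N); positivity
  exact h2.trans_le h1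

lemma criticalPoint_enhancedPerc {E : Enhancement L} (hmono : E.IsMonotonic)
    (hness : ¬ E.IsEssential) (s : I) :
    criticalPoint (enhancedPerc E s) = criticalPoint (indepPerc L) := by
  refine le_antisymm (sSup_le_sSup fun p hp => ?_) (sSup_le fun p hp => ?_)
  · exact le_antisymm ((theta_le_theta s p).trans_eq hp) measureReal_nonneg
  · -- The comparison says nothing at density `0`, but `0` does not matter for the supremum.
    rcases eq_or_lt_of_le p.2.1 with h0 | h0
    · exact (show p ≤ criticalPoint (enhancedPerc E s) by
        rw [show p = 0 from Subtype.ext h0.symm]; exact unitInterval.nonneg')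
    · obtain ⟨_, _, -, -, hcomp⟩ := exists_comparison hmono hness s h0
      refine le_sSup (le_antisymm ?_ measureReal_nonneg)
      have := (hcomp p le_rfl).1
      rwa [show theta (indepPerc L) p = 0 from hp, mul_zero] at this

end CriticalPoint

/-! ### Critical exponents -/

/-- If `a = 0` then `b = 0`, so that the bound holds also with the value `0` of the logarithm
at `0`. -/
lemma abs_log_sub_log_le {a b C : ℝ} (ha : 0 ≤ a) (hab : a ≤ b) (hb : b ≤ C * a) (hC : 1 ≤ C) :
    |Real.log b - Real.log a| ≤ Real.log C := by
  rcases ha.eq_or_lt with rfl | ha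
  · rw [mul_zero] at hb
    simpa [le_antisymm hb hab] using Real.log_nonneg hC
  · have h1 : Real.log a ≤ Real.log b := Real.log_le_log ha hab
    have h2 : Real.log b ≤ Real.log C + Real.log a := by
      rw [← Real.log_mul (by positivity) ha.ne']
      exact Real.log_le_log (ha.trans_le hab) hb
    rw [abs_of_nonneg (by linarith)]
    linarith

lemma tendsto_div_of_abs_sub_le {α : Type*} {l : Filter α} {f g h : α → ℝ} {a K : ℝ}
    (hf : Tendsto (fun x => f x / h x) l (𝓝 a)) (hh : Tendsto (fun x => |h x|) l atTop)
    (hK : ∀ᶠ x in l, |g x - f x| ≤ K) : Tendsto (fun x => g x / h x) l (𝓝 a) := by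
  have h0 : Tendsto (fun x => (g x - f x) / h x) l (𝓝 0) := by
    refine squeeze_zero_norm' ?_ (hh.const_div_atTop K)
    filter_upwards [hK] with x hx
    rw [norm_div, Real.norm_eq_abs, Real.norm_eq_abs]
    gcongr
  refine (by simpa using hf.add h0 : Tendsto _ l (𝓝 a)).congr fun x => ?_
  ring

lemma tendsto_norm_pos_cofinite {L : PlanarLattice} :
    Tendsto (fun x : L.Site => ‖pos x‖) cofinite atTop := by
  refine tendsto_atTop.2 fun r => ?_
  obtain ⟨m, hm⟩ := exists_nat_ge (2 * r + 2)
  refine ((box_finite L.origin m).subset ?_ : Set.Finite _)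
  intro x hx
  refine ball_subset_box L.origin r hm ?_
  have h0 : pos L.origin = 0 := by simp [pos, PlanarLattice.origin]
  have : ¬ r ≤ ‖pos x‖ := hx
  change ‖pos x - pos L.origin‖ ≤ r
  rw [h0, sub_zero]
  exact (not_le.1 this).le

lemma tendsto_abs_log_sub_nhdsGT (c : I) :
    Tendsto (fun p : I => |Real.log ((p : ℝ) - c)|) (𝓝[>] c) atTop := by
  refine tendsto_abs_atBot_atTop.comp (Real.tendsto_log_nhdsGT_zero.comp ?_)
  refine tendsto_nhdsWithin_iff.2 ⟨?_, ?_⟩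
  · have : Tendsto (fun p : I => (p : ℝ) - c) (𝓝 c) (𝓝 ((c : ℝ) - c)) :=
      (continuous_subtype_val.sub continuous_const).tendsto c
    rw [sub_self] at this
    exact this.mono_left nhdsWithin_le_nhds
  · filter_upwards [self_mem_nhdsWithin] with p hp
    exact sub_pos.2 (show (c : ℝ) < p from hp)

lemma tendsto_abs_log_sub_nhdsLT (c : I) :
    Tendsto (fun p : I => |Real.log ((c : ℝ) - p)|) (𝓝[<] c) atTop := by
  refine tendsto_abs_atBot_atTop.comp (Real.tendsto_log_nhdsGT_zero.comp ?_)
  refine tendsto_nhdsWithin_iff.2 ⟨?_, ?_⟩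
  · have : Tendsto (fun p : I => (c : ℝ) - p) (𝓝 c) (𝓝 ((c : ℝ) - c)) :=
      (continuous_const.sub continuous_subtype_val).tendsto c
    rw [sub_self] at this
    exact this.mono_left nhdsWithin_le_nhds
  · filter_upwards [self_mem_nhdsWithin] with p hp
    exact sub_pos.2 (show (p : ℝ) < c from hp)

/-- Tails which agree up to constant factors in the value and in the argument have the same
polynomial decay exponent. As the exponent is not `0`, the tail `a` is eventually positive, so that
the value `0` of the logarithm at `0` plays no role. -/
lemma tendsto_log_div_log_of_le {a b : ℕ → ℝ} {C δ : ℝ} {D : ℕ} (hC : 1 ≤ C) (hD : 0 < D)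
    (ha : ∀ n, 0 ≤ a n) (hab : ∀ n, a n ≤ b n) (hba : ∀ n, b n ≤ C * a (n / D)) (hδ : 0 < δ)
    (h : Tendsto (fun n : ℕ => Real.log (a n) / Real.log n) atTop (𝓝 (-(1 / δ)))) :
    Tendsto (fun n : ℕ => Real.log (b n) / Real.log n) atTop (𝓝 (-(1 / δ))) := by
  have hneg : -(1 / δ) < 0 := by have := one_div_pos.2 hδ; linarith
  have hapos : ∀ᶠ n in atTop, 0 < a n := by
    -- Where `a n = 0`, the quotient is `0`.
    filter_upwards [h.eventually_lt_const hneg] with n hn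
    refine (ha n).lt_of_ne fun h0 => ?_
    rw [← h0] at hn
    simp at hn
  have hdiv : Tendsto (fun n => n / D) atTop atTop := Nat.tendsto_div_const_atTop hD.ne'
  have hlog : Tendsto (fun n : ℕ => Real.log n) atTop atTop :=
    Real.tendsto_log_atTop.comp tendsto_natCast_atTop_atTop
  have hratio : Tendsto (fun n : ℕ => Real.log ((n / D : ℕ) : ℝ) / Real.log n) atTop (𝓝 1) := by
    refine tendsto_div_of_abs_sub_le (f := fun n : ℕ => Real.log n) (K := Real.log (2 * D)) ?_
      (tendsto_abs_atTop_atTop.comp hlog) ?_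
    · refine tendsto_const_nhds.congr' ?_
      filter_upwards [hlog.eventually_gt_atTop 0] with n hn
      rw [div_self hn.ne']
    · filter_upwards [eventually_ge_atTop D] with n hn
      rw [abs_sub_comm]
      have h1 : 1 ≤ n / D := (Nat.one_le_div_iff hD).2 hn
      refine abs_log_sub_log_le (Nat.cast_nonneg _) (by exact_mod_cast Nat.div_le_self _ _) ?_ ?_
      · have h2 : n < (n / D + 1) * D := by
          rw [← Nat.div_lt_iff_lt_mul hD]; omega
        have : n ≤ 2 * D * (n / D) := by nlinarith
        exact_mod_cast this
      · have : 1 ≤ 2 * D := by omega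
        exact_mod_cast this
  have hupper : Tendsto (fun n : ℕ => Real.log C / Real.log n +
      Real.log (a (n / D)) / Real.log ((n / D : ℕ) : ℝ) *
        (Real.log ((n / D : ℕ) : ℝ) / Real.log n)) atTop (𝓝 (-(1 / δ))) := by
    simpa using (hlog.const_div_atTop (Real.log C)).add ((h.comp hdiv).mul hratio)
  refine tendsto_of_tendsto_of_tendsto_of_le_of_le' h hupper ?_ ?_
  · filter_upwards [hapos, hlog.eventually_gt_atTop 0] with n hn hn'
    gcongr
    exact hab n
  · filter_upwards [hapos, hdiv.eventually hapos, hlog.eventually_gt_atTop 0,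
      (hlog.comp hdiv).eventually_gt_atTop 0] with n hn hn1 hn2 hn3
    have hn3' : Real.log ((n / D : ℕ) : ℝ) ≠ 0 := ne_of_gt hn3
    have hlb : Real.log (b n) ≤ Real.log C + Real.log (a (n / D)) := by
      rw [← Real.log_mul (by positivity) hn1.ne']
      exact Real.log_le_log (hn.trans_le (hab n)) (hba n)
    rw [div_mul_div_cancel₀ hn3', ← add_div]
    gcongr

section Exponents

variable {L : PlanarLattice} {E : Enhancement L}

open Percolation

lemma hasBeta_enhancedPerc (hmono : E.IsMonotonic) (hness : ¬ E.IsEssential) (s : I) {β : ℝ}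
    (h : HasBeta (indepPerc L) β) : HasBeta (enhancedPerc E s) β := by
  obtain ⟨C, D, hC, -, hcomp⟩ := exists_comparison hmono hness s (criticalPoint_pos (L := L))
  unfold HasBeta
  rw [criticalPoint_enhancedPerc hmono hness]
  refine tendsto_div_of_abs_sub_le (K := Real.log C) h (tendsto_abs_log_sub_nhdsGT _) ?_
  filter_upwards [self_mem_nhdsWithin] with p hp
  exact abs_log_sub_log_le measureReal_nonneg (theta_le_theta s p)
    (hcomp p (le_of_lt hp)).1 hC

lemma abs_log_tau_sub_le {s p : I} {C : ℝ} (hC : 1 ≤ C) {x : L.Site}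
    (h : tau (enhancedPerc E s) p x ≤ C * tau (indepPerc L) p x) :
    |Real.log (tau (enhancedPerc E s) p x) - Real.log (tau (indepPerc L) p x)| ≤ Real.log C :=
  abs_log_sub_log_le measureReal_nonneg (tau_le_tau s p x) h hC

lemma hasEta_enhancedPerc (hmono : E.IsMonotonic) (hness : ¬ E.IsEssential) (s : I) {η : ℝ}
    (h : HasEta (indepPerc L) η) : HasEta (enhancedPerc E s) η := by
  obtain ⟨C, D, hC, -, hcomp⟩ := exists_comparison hmono hness s (criticalPoint_pos (L := L))
  unfold HasEta
  rw [criticalPoint_enhancedPerc hmono hness]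
  refine tendsto_div_of_abs_sub_le (K := Real.log C) h (tendsto_abs_atTop_atTop.comp
    (Real.tendsto_log_atTop.comp tendsto_norm_pos_cofinite)) (Eventually.of_forall fun x => ?_)
  exact abs_log_tau_sub_le hC ((hcomp _ le_rfl).2.1 x)

lemma hasCorrelationLength_enhancedPerc {S : Set L.Site} {s p : I} {C ξ : ℝ} (hC : 1 ≤ C)
    (hcomp : ∀ x, tau (enhancedPerc E s) p x ≤ C * tau (indepPerc L) p x)
    (h : HasCorrelationLength (indepPerc L) S p ξ) :
    HasCorrelationLength (enhancedPerc E s) S p ξ := by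
  refine ⟨h.1, ?_⟩
  have hdiv : ∀ μ : I → Measure (Set L.Site), (fun x : L.Site =>
      -(1 / ‖pos x‖) * Real.log (tau μ p x)) = fun x => -Real.log (tau μ p x) / ‖pos x‖ := by
    intro μ; ext x; ring
  have h2 := h.2
  rw [hdiv] at h2 ⊢
  refine tendsto_div_of_abs_sub_le (K := Real.log C) h2 ?_ (Eventually.of_forall fun x => ?_)
  · simp only [abs_norm]
    exact tendsto_norm_pos_cofinite.mono_left inf_le_left
  · rw [neg_sub_neg, abs_sub_comm]
    exact abs_log_tau_sub_le hC (hcomp x)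

/-- Just below the critical point the density is bounded away from `0`. -/
lemma eventually_half_criticalPoint_le : ∀ᶠ p : I in 𝓝[<] (criticalPoint (indepPerc L)),
    (criticalPoint (indepPerc L) : ℝ) / 2 ≤ p := by
  have hpos := criticalPoint_pos (L := L)
  have : ∀ᶠ p : I in 𝓝 (criticalPoint (indepPerc L)),
      (criticalPoint (indepPerc L) : ℝ) / 2 < p :=
    continuous_subtype_val.continuousAt.eventually (lt_mem_nhds (by linarith))
  filter_upwards [this.filter_mono nhdsWithin_le_nhds] with p hp
  exact hp.le

lemma hasNu_enhancedPerc (hmono : E.IsMonotonic) (hness : ¬ E.IsEssential) (s : I)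
    {S : Set L.Site} {ν : ℝ} (h : HasNu (indepPerc L) S ν) : HasNu (enhancedPerc E s) S ν := by
  obtain ⟨C, D, hC, -, hcomp⟩ :=
    exists_comparison hmono hness s (half_pos (criticalPoint_pos (L := L)))
  obtain ⟨ξ, hξ, hlim⟩ := h
  unfold HasNu
  rw [criticalPoint_enhancedPerc hmono hness]
  refine ⟨ξ, ?_, hlim⟩
  filter_upwards [hξ, eventually_half_criticalPoint_le] with p hp hp'
  exact hasCorrelationLength_enhancedPerc hC (hcomp p hp').2.1 hp

lemma hasGamma_enhancedPerc (hmono : E.IsMonotonic) (hness : ¬ E.IsEssential) (s : I) {γ : ℝ}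
    (h : HasGamma (indepPerc L) γ) : HasGamma (enhancedPerc E s) γ := by
  obtain ⟨C, D, hC, -, hcomp⟩ :=
    exists_comparison hmono hness s (half_pos (criticalPoint_pos (L := L)))
  obtain ⟨hfin, hlim⟩ := h
  unfold HasGamma
  rw [criticalPoint_enhancedPerc hmono hness]
  have hfin' : ∀ᶠ p in 𝓝[<] (criticalPoint (indepPerc L)), chi (enhancedPerc E s) p ≠ ⊤ := by
    filter_upwards [hfin, eventually_half_criticalPoint_le] with p hp hp'
    exact ne_top_of_le_ne_top (ENNReal.mul_ne_top ENNReal.ofReal_ne_top hp) (hcomp p hp').2.2.1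
  refine ⟨hfin', tendsto_div_of_abs_sub_le (K := Real.log C) hlim (tendsto_abs_log_sub_nhdsLT _) ?_⟩
  filter_upwards [hfin, hfin', eventually_half_criticalPoint_le] with p hp hp1 hp2
  refine abs_log_sub_log_le ENNReal.toReal_nonneg (ENNReal.toReal_mono hp1 (chi_le_chi s p)) ?_ hC
  have := ENNReal.toReal_mono (ENNReal.mul_ne_top ENNReal.ofReal_ne_top hp) (hcomp p hp2).2.2.1
  rwa [ENNReal.toReal_mul, ENNReal.toReal_ofReal (zero_le_one.trans hC)] at this

lemma hasDelta_enhancedPerc (hmono : E.IsMonotonic) (hness : ¬ E.IsEssential) (s : I) {δ : ℝ}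
    (h : HasDelta (indepPerc L) δ) : HasDelta (enhancedPerc E s) δ := by
  obtain ⟨C, D, hC, hD, hcomp⟩ := exists_comparison hmono hness s (criticalPoint_pos (L := L))
  unfold HasDelta
  rw [criticalPoint_enhancedPerc hmono hness]
  exact ⟨h.1, tendsto_log_div_log_of_le hC hD (fun _ => measureReal_nonneg)
    (fun n => measure_le_encard_le s _ n) (hcomp _ le_rfl).2.2.2 h.1 h.2⟩

end Exponents

theorem mainTheorem8 (L : PlanarLattice) (E : Enhancement L) (hmono : E.IsMonotonic)
    (hness : ¬ E.IsEssential) (s : unitInterval) :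
    (∀ β : ℝ, Percolation.HasBeta (indepPerc L) β →
      Percolation.HasBeta (enhancedPerc E s) β) ∧
    (∀ η : ℝ, Percolation.HasEta (indepPerc L) η →
      Percolation.HasEta (enhancedPerc E s) η) ∧
    (∀ S : Set L.Site, S.Infinite → ∀ ν : ℝ, Percolation.HasNu (indepPerc L) S ν →
      Percolation.HasNu (enhancedPerc E s) S ν) ∧
    (∀ γ : ℝ, Percolation.HasGamma (indepPerc L) γ →
      Percolation.HasGamma (enhancedPerc E s) γ) ∧
    (∀ δ : ℝ, Percolation.HasDelta (indepPerc L) δ →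
      Percolation.HasDelta (enhancedPerc E s) δ) :=
  ⟨fun _ => hasBeta_enhancedPerc hmono hness s, fun _ => hasEta_enhancedPerc hmono hness s,
    fun _ _ _ => hasNu_enhancedPerc hmono hness s, fun _ => hasGamma_enhancedPerc hmono hness s,
    fun _ => hasDelta_enhancedPerc hmono hness s⟩
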